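/- Let $m\ge 2$, $d\ge 1$ be integers, and let $A$ be a primitive $m\times m$ matrix with entries in $\{0,1\}$ (i.e. some power $A^p$, $p\ge1$, has only positive entries). Let $\Sigma_A=\{x=(x_k)_{k\ge1}\in\{1,\dots,m\}^{\mathbb N}: A_{x_k x_{k+1}}=1 \text{ for all } k\ge 1\}$, with the shift $\sigma$ and the metric $d(x,y)=m^{-n}$ for $x\ne y$, where $n$ is the smallest $k$ with $x_k\neq y_k$ (and $d(x,x)=0$). Let $\Sigma_{A,n}$ be the set of words $J=j_1\cdots j_n$ over $\{1,\dots,m\}$ with $A_{j_i j_{i+1}}=1$ for $1\le i<n$, and put $[J]=\{x\in\Sigma_A: x_i=j_i,\ 1\le i\le n\}$. For a non-negative $d\times d$ matrix $B$ let $\|B\|=\mathbf 1^tB\mathbf 1$ be the sum of its entries. Let $M$ be a Hölder continuous function on $\Sigma_A$ taking values in the $d\times d$ matrices with (strictly) positive entries. Then for every $q\in\mathbb R$ the limit $$P(q)=\lim_{n\to\infty}\frac1n\log\sum_{J\in\Sigma_{A,n}}\ \sup_{x\in[J]}\big\|M(x)M(\sigma x)\cdots M(\sigma^{n-1}x)\big\|^q$$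 exists (and is a real number), and the pressure function $P:\mathbb R\to\mathbb R$ is differentiable at every $q\neq 0$. -/

import Mathlib

open Filter Topology

noncomputable section

namespace MatrixPressure

/-- The one-sided subshift of finite type `Σ_A`; coordinates are numbered from `0`. -/
def Subshift {m : ℕ} (A : Matrix (Fin m) (Fin m) ℝ) : Type :=
  {x : ℕ → Fin m // ∀ k, A (x k) (x (k + 1)) = 1}

/-- The left shift on `Σ_A`. -/
def shift {m : ℕ} {A : Matrix (Fin m) (Fin m) ℝ} (x : Subshift A) : Subshift A :=
  ⟨fun k => x.1 (k + 1), fun k => x.2 (k + 1)⟩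

/-- The metric `d(x, y) = m ^ (-n)`, where `n` is the least position at which `x` and `y` differ,
positions being counted from `1` (hence the `+ 1`, as `PiNat.firstDiff` counts from `0`). -/
def symbolicDist {m : ℕ} (x y : ℕ → Fin m) : ℝ :=
  open Classical in if x = y then 0 else ((m : ℝ) ^ (PiNat.firstDiff x y + 1))⁻¹

/-- Hölder continuity of a matrix-valued function on `Σ_A`, for the metric above (entrywise, which
is the same as for any norm on matrices). -/
def IsHolder {m d : ℕ} {A : Matrix (Fin m) (Fin m) ℝ}
    (M : Subshift A → Matrix (Fin d) (Fin d) ℝ) : Prop :=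
  ∃ C α : ℝ, 0 < α ∧ ∀ x y : Subshift A, ∀ i j : Fin d,
    |M x i j - M y i j| ≤ C * symbolicDist x.1 y.1 ^ α

/-- `‖B‖ = 𝟏ᵗ B 𝟏`, the sum of all entries; a norm on non-negative matrices. -/
def entrySum {d : ℕ} (B : Matrix (Fin d) (Fin d) ℝ) : ℝ :=
  ∑ i, ∑ j, B i j

/-- The product `M(x) M(σ x) ⋯ M(σ^{n-1} x)`. -/
def cocycle {m d : ℕ} {A : Matrix (Fin m) (Fin m) ℝ}
    (M : Subshift A → Matrix (Fin d) (Fin d) ℝ) (n : ℕ) (x : Subshift A) :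
    Matrix (Fin d) (Fin d) ℝ :=
  ((List.range n).map fun k => M (shift^[k] x)).prod

/-- A word `J` of length `n` is admissible if all its transitions are allowed by `A`. -/
def IsAdmissible {m : ℕ} (A : Matrix (Fin m) (Fin m) ℝ) {n : ℕ} (J : Fin n → Fin m) : Prop :=
  ∀ i j : Fin n, (j : ℕ) = i + 1 → A (J i) (J j) = 1

/-- The set `Σ_{A,n}` of admissible words of length `n`. -/
def admissibleWords {m : ℕ} (A : Matrix (Fin m) (Fin m) ℝ) (n : ℕ) : Finset (Fin n → Fin m) :=
  open Classical in Finset.univ.filter fun J => IsAdmissible A J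

/-- The cylinder `[J]` in `Σ_A`. -/
def cylinder {m : ℕ} (A : Matrix (Fin m) (Fin m) ℝ) {n : ℕ} (J : Fin n → Fin m) :
    Set (Subshift A) :=
  {x | ∀ i : Fin n, x.1 i = J i}

/-- `s_n(q) = ∑_{J ∈ Σ_{A,n}} sup_{x ∈ [J]} ‖M(x) M(σ x) ⋯ M(σ^{n-1} x)‖ ^ q`. -/
def partitionSum {m d : ℕ} {A : Matrix (Fin m) (Fin m) ℝ}
    (M : Subshift A → Matrix (Fin d) (Fin d) ℝ) (n : ℕ) (q : ℝ) : ℝ :=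
  ∑ J ∈ admissibleWords A n, ⨆ x : cylinder A J, entrySum (cocycle M n x.1) ^ q

/-- The pressure function `P(q) = lim (1/n) log s_n(q)`. -/
def pressure {m d : ℕ} {A : Matrix (Fin m) (Fin m) ℝ}
    (M : Subshift A → Matrix (Fin d) (Fin d) ℝ) (q : ℝ) : ℝ :=
  limUnder atTop fun n : ℕ => (1 / (n : ℝ)) * Real.log (partitionSum M n q)

end MatrixPressure

end

/-! Positive matrices contract the projective metric of the positive cone (Birkhoff). The vectors of
row sums of `cocycle M n` at two points that agree on `l` symbols are therefore exponentially close
in `l`, projectively and uniformly in `n`. The increment `logIncr M n x = log ‖M(x) ⋯ M(σⁿ x)‖ - log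
‖M(σ x) ⋯ M(σⁿ x)‖` depends only on `M x` and the projective class of such a vector, so it is
bounded and Hölder continuous with constants independent of `n` (`exists_logNorm_bounds`). Thus `log
‖M(x) ⋯ M(σ^{n-1} x)‖` is, up to the constant `log d`, a sum along the orbit of a sequence of
potentials that varies with `n` but is uniformly regular.

The norm is multiplicative up to a bounded factor on both sides, so for either sign of `q` the
partition sums are submultiplicative up to a constant, and Fekete's lemma gives the limit.

For differentiability, bounded distortion replaces the partition sum by a sum over the `n`-th
preimages of one point, at the cost of a bounded error in the logarithm. This sum is an iterated
transfer operator; the logarithm `logPartition` has derivatives `meanEnergy` and `energyVar`, a mean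
and a variance for a backward Markov chain. By the law of total variance, `energyVar` grows linearly
in `n` as soon as the oscillation of `meanEnergy` over the starting point stays bounded
(`exists_meanEnergy_osc_bound`). That bound is a coupling argument: mixing gives any two points
preimages with a long common prefix, reached with probability bounded below.

Hence the functions `(1/n) logPartition` have second derivatives bounded locally in `q`, uniformly
in `n`, and their pointwise limit, the pressure, is differentiable. -/

noncomputable section

namespace MatrixPressure

variable {m d : ℕ} {A : Matrix (Fin m) (Fin m) ℝ}

/-! ### Points that agree on an initial segment -/

/-- `x` and `y` have the same first `l` symbols. -/
def Agree (l : ℕ) (x y : Subshift A) : Prop := ∀ i < l, x.1 i = y.1 i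

lemma Agree.symm {l : ℕ} {x y : Subshift A} (h : Agree l x y) : Agree l y x :=
  fun i hi => (h i hi).symm

lemma Agree.shift {l : ℕ} {x y : Subshift A} (h : Agree (l + 1) x y) :
    Agree l (shift x) (shift y) := fun i hi => h (i + 1) (by omega)

lemma symbolicDist_nonneg (x y : ℕ → Fin m) : 0 ≤ symbolicDist x y := by
  unfold symbolicDist
  split_ifs
  · exact le_rfl
  · positivity

lemma symbolicDist_rpow_le (hm : 2 ≤ m) {α : ℝ} (hα : 0 < α) {l : ℕ} {x y : Subshift A}
    (h : Agree l x y) : symbolicDist x.1 y.1 ^ α ≤ ((m : ℝ) ^ (-α)) ^ l := by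
  have hm0 : (0 : ℝ) < m := by positivity
  have hm1 : (1 : ℝ) ≤ m := by exact_mod_cast (by omega : 1 ≤ m)
  by_cases hxy : x.1 = y.1
  · simp only [symbolicDist, hxy, if_true]
    rw [Real.zero_rpow hα.ne']
    positivity
  · have hl : l ≤ PiNat.firstDiff x.1 y.1 := by
      by_contra hlt
      exact PiNat.apply_firstDiff_ne hxy (h _ (not_le.1 hlt))
    have h1 : symbolicDist x.1 y.1 ≤ ((m : ℝ) ^ l)⁻¹ := by
      simp only [symbolicDist, hxy, if_false]
      exact inv_anti₀ (by positivity) (pow_le_pow_right₀ hm1 (by omega))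
    refine (Real.rpow_le_rpow (symbolicDist_nonneg _ _) h1 hα.le).trans_eq ?_
    rw [Real.inv_rpow (by positivity), ← Real.rpow_natCast, ← Real.rpow_natCast,
      ← Real.rpow_mul hm0.le, ← Real.rpow_mul hm0.le, ← Real.rpow_neg hm0.le]
    congr 1
    ring

lemma IsHolder.exists_agree_bound (hm : 2 ≤ m) {M : Subshift A → Matrix (Fin d) (Fin d) ℝ}
    (hM : IsHolder M) : ∃ C τ : ℝ, 0 ≤ C ∧ 0 < τ ∧ τ < 1 ∧
      ∀ l x y, Agree l x y → ∀ i j, |M x i j - M y i j| ≤ C * τ ^ l := by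
  obtain ⟨C, α, hα, h⟩ := hM
  have hm1 : (1 : ℝ) < m := by exact_mod_cast (by omega : 1 < m)
  -- One more common symbol divides the distance by `m`, hence its power `α` by `m ^ α`. The
  -- absolute value covers a negative `C`.
  refine ⟨|C|, (m : ℝ) ^ (-α), abs_nonneg _, by positivity,
    Real.rpow_lt_one_of_one_lt_of_neg hm1 (by linarith), fun l x y hxy i j => ?_⟩
  refine (h x y i j).trans (mul_le_mul (le_abs_self _) (symbolicDist_rpow_le hm hα hxy) ?_
    (abs_nonneg _))
  exact Real.rpow_nonneg (symbolicDist_nonneg _ _) _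

/-! ### Compactness of the subshift and bounds for the entries -/

instance : TopologicalSpace (Subshift A) :=
  inferInstanceAs (TopologicalSpace {x : ℕ → Fin m // ∀ k, A (x k) (x (k + 1)) = 1})

instance : CompactSpace (Subshift A) := by
  have hcl : IsClosed {x : ℕ → Fin m | ∀ k, A (x k) (x (k + 1)) = 1} := by
    simp only [Set.ofPred_forall]
    refine isClosed_iInter fun k => ?_
    have hc : Continuous fun x : ℕ → Fin m => A (x k) (x (k + 1)) :=
      Continuous.comp (g := fun p : Fin m × Fin m => A p.1 p.2)
        (f := fun x : ℕ → Fin m => (x k, x (k + 1))) continuous_of_discreteTopology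
        ((continuous_apply k).prodMk (continuous_apply (k + 1)))
    exact isClosed_eq hc continuous_const
  exact isCompact_iff_compactSpace.1 hcl.isCompact

lemma eventually_agree (l : ℕ) (x : Subshift A) : ∀ᶠ y in 𝓝 x, Agree l y x := by
  have h : ∀ i < l, ∀ᶠ y : Subshift A in 𝓝 x, y.1 i = x.1 i := fun i _ => by
    have hc : Continuous fun y : Subshift A => y.1 i :=
      (continuous_apply i).comp continuous_subtype_val
    exact hc.continuousAt.eventually (eventually_of_mem (isOpen_discrete {x.1 i} |>.mem_nhds rfl)
      fun _ h => h)
  exact (eventually_all_finite (Set.finite_lt_nat l)).2 h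

lemma continuous_of_agree_bound {f : Subshift A → ℝ} {C τ : ℝ} (hτ0 : 0 < τ) (hτ1 : τ < 1)
    (hf : ∀ l x y, Agree l x y → |f x - f y| ≤ C * τ ^ l) : Continuous f := by
  refine continuous_iff_continuousAt.2 fun x => Metric.tendsto_nhds.2 fun ε hε => ?_
  have ht : Tendsto (fun l : ℕ => C * τ ^ l) atTop (𝓝 (C * 0)) :=
    (tendsto_pow_atTop_nhds_zero_of_lt_one hτ0.le hτ1).const_mul C
  rw [mul_zero] at ht
  obtain ⟨l, hl⟩ := (ht.eventually (gt_mem_nhds hε)).exists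
  filter_upwards [eventually_agree l x] with y hy
  exact (hf l y x hy).trans_lt hl

/-- A positive Hölder continuous matrix function has entries in a compact subinterval of `(0, ∞)`
and its entries have Hölder continuous logarithms. -/
lemma IsHolder.exists_entry_bounds (hm : 2 ≤ m) {M : Subshift A → Matrix (Fin d) (Fin d) ℝ}
    (hM : IsHolder M) (hpos : ∀ x i j, 0 < M x i j) :
    ∃ K c τ : ℝ, 1 ≤ K ∧ 0 ≤ c ∧ 0 < τ ∧ τ < 1 ∧ (∀ x i j, K⁻¹ ≤ M x i j ∧ M x i j ≤ K) ∧
      ∀ l x y, Agree l x y → ∀ i j, M x i j ≤ Real.exp (c * τ ^ l) * M y i j := by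
  obtain ⟨C, τ, hC, hτ0, hτ1, h⟩ := hM.exists_agree_bound hm
  have hb : ∀ p : Fin d × Fin d, ∃ K : ℝ, 1 ≤ K ∧ ∀ x, K⁻¹ ≤ M x p.1 p.2 ∧ M x p.1 p.2 ≤ K := by
    intro p
    have hc : Continuous fun x => M x p.1 p.2 :=
      continuous_of_agree_bound hτ0 hτ1 fun l x y hxy => h l x y hxy p.1 p.2
    rcases isEmpty_or_nonempty (Subshift A) with he | hne
    · exact ⟨1, le_rfl, fun x => he.elim x⟩
    · obtain ⟨y, -, hy⟩ := isCompact_univ.exists_isMinOn Set.univ_nonempty hc.continuousOn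
      obtain ⟨z, -, hz⟩ := isCompact_univ.exists_isMaxOn Set.univ_nonempty hc.continuousOn
      refine ⟨max 1 (max (M y p.1 p.2)⁻¹ (M z p.1 p.2)), le_max_left _ _, fun x => ⟨?_, ?_⟩⟩
      · refine (inv_anti₀ (inv_pos.2 (hpos y p.1 p.2))
          ((le_max_left _ _).trans (le_max_right _ _))).trans ?_
        rw [inv_inv]
        exact hy (Set.mem_univ x)
      · exact (hz (Set.mem_univ x)).trans ((le_max_right _ _).trans (le_max_right _ _))
  choose k hk1 hk using hb
  set K : ℝ := 1 + ∑ p, k p with hK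
  have hkK : ∀ p, k p ≤ K := fun p => by
    have := Finset.single_le_sum (f := k) (fun q _ => zero_le_one.trans (hk1 q))
      (Finset.mem_univ p)
    linarith
  have hK1 : 1 ≤ K := by
    have := Finset.sum_nonneg (s := Finset.univ) (f := k) (fun q _ => zero_le_one.trans (hk1 q))
    linarith
  have hbd : ∀ x i j, K⁻¹ ≤ M x i j ∧ M x i j ≤ K := fun x i j =>
    ⟨(inv_anti₀ (by linarith [hk1 (i, j)]) (hkK (i, j))).trans (hk (i, j) x).1,
      (hk (i, j) x).2.trans (hkK (i, j))⟩
  -- Since `1 ≤ K * M y i j`, the additive error `C τ^l` is at most `C K τ^l * M y i j`, and `1 + s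
  -- ≤ exp s` makes it multiplicative.
  refine ⟨K, C * K, τ, hK1, by positivity, hτ0, hτ1, hbd, fun l x y hxy i j => ?_⟩
  have h1 := (le_abs_self _).trans (h l x y hxy i j)
  have h2 : 1 ≤ K * M y i j := by
    have := mul_le_mul_of_nonneg_left (hbd y i j).1 (by linarith : 0 ≤ K)
    rwa [mul_inv_cancel₀ (by linarith)] at this
  have h3 : 0 ≤ C * τ ^ l := by positivity
  have h4 := Real.add_one_le_exp (C * K * τ ^ l)
  have h5 := mul_le_mul_of_nonneg_right h4 (hpos y i j).le
  nlinarith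

/-! ### A contraction property of positive matrices -/

/-- `v` and `w` are within `h` of each other in the projective metric of the positive cone. -/
def ProjClose (h : ℝ) (v w : Fin d → ℝ) : Prop := ∀ i j, v i * w j ≤ Real.exp h * (v j * w i)

/-- Turns a gain in the ratio `exp h - 1` into a contraction of `h` itself. With `s = δ exp (-H)`,
`exp ((1 - s) h) ≥ exp h - s h exp h ≥ exp h - δ h`, and `h ≤ exp h - 1`. The rate is uniform only
for bounded `h`. -/
lemma one_add_mul_le_exp {δ h H : ℝ} (hδ : 0 ≤ δ) (h0 : 0 ≤ h) (hH : h ≤ H) :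
    1 + (1 - δ) * (Real.exp h - 1) ≤ Real.exp ((1 - δ * Real.exp (-H)) * h) := by
  set s := δ * Real.exp (-H) with hs
  have h1 : Real.exp ((1 - s) * h) = Real.exp h * Real.exp (-(s * h)) := by
    rw [← Real.exp_add]; ring_nf
  have h2 : 1 - s * h ≤ Real.exp (-(s * h)) := by linarith [Real.add_one_le_exp (-(s * h))]
  have h3 : s * Real.exp h ≤ δ := by
    rw [hs, mul_assoc, ← Real.exp_add]
    refine mul_le_of_le_one_right hδ ?_
    rw [Real.exp_le_one_iff]; linarith
  have h4 := Real.add_one_le_exp h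
  rw [h1]
  nlinarith [mul_le_mul_of_nonneg_left h2 (Real.exp_pos h).le, mul_le_mul_of_nonneg_right h3 h0,
    mul_le_mul_of_nonneg_left h4 hδ]

/-- Birkhoff contraction. With `t = min v/w`, the vector `exp h * t * w - v` is non-negative, so `B`
sends it to a vector whose entries are comparable within `K`. A definite share of the slack at `j`
therefore reappears at `i`, which improves the upper bound for `(B v) i`. -/
lemma ProjClose.mulVec [NeZero d] {B : Matrix (Fin d) (Fin d) ℝ} {K h : ℝ} (hK : 1 ≤ K)
    (hB0 : ∀ i j, 0 < B i j) (hB : ∀ i j k, B i k ≤ K * B j k) {v w : Fin d → ℝ}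
    (hv : ∀ i, 0 < v i) (hw : ∀ i, 0 < w i) (hvw : ProjClose h v w) (i j : Fin d) :
    (B.mulVec v) i * (B.mulVec w) j ≤
      (1 + (1 - (K ^ 2)⁻¹) * (Real.exp h - 1)) * ((B.mulVec v) j * (B.mulVec w) i) := by
  obtain ⟨k, -, hk⟩ := Finset.exists_min_image Finset.univ (fun i => v i / w i)
    ⟨(0 : Fin d), Finset.mem_univ _⟩
  set t := v k / w k with ht
  have hlow : ∀ l, t * w l ≤ v l := fun l => (le_div_iff₀ (hw l)).1 (hk l (Finset.mem_univ l))
  have hup : ∀ l, v l ≤ Real.exp h * (t * w l) := fun l => by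
    have := hvw l k
    rw [ht, div_mul_eq_mul_div, mul_div_assoc', le_div_iff₀ (hw k)]
    exact this
  set E := Real.exp h
  have hpos : ∀ u : Fin d → ℝ, (∀ i, 0 < u i) → ∀ i, 0 < (B.mulVec u) i := fun u hu i =>
    Finset.sum_pos (fun l _ => mul_pos (hB0 i l) (hu l)) ⟨(0 : Fin d), Finset.mem_univ _⟩
  have hcomp : ∀ u : Fin d → ℝ, (∀ i, 0 ≤ u i) → ∀ i j, (B.mulVec u) i ≤ K * (B.mulVec u) j := by
    intro u hu i j
    simp only [Matrix.mulVec, dotProduct, Finset.mul_sum]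
    exact Finset.sum_le_sum fun l _ => by
      rw [← mul_assoc]; exact mul_le_mul_of_nonneg_right (hB i j l) (hu l)
  have hz : ∀ i, (B.mulVec fun l => E * (t * w l) - v l) i
      = E * t * (B.mulVec w) i - (B.mulVec v) i := fun i => by
    simp only [Matrix.mulVec, dotProduct, Finset.mul_sum, ← Finset.sum_sub_distrib]
    exact Finset.sum_congr rfl fun l _ => by ring
  have hlowB : t * (B.mulVec w) j ≤ (B.mulVec v) j := by
    simp only [Matrix.mulVec, dotProduct, Finset.mul_sum]
    exact Finset.sum_le_sum fun l _ => by
      have := mul_le_mul_of_nonneg_left (hlow l) (hB0 j l).le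
      linarith
  have h1 := hcomp (fun l => E * (t * w l) - v l) (fun l => sub_nonneg.2 (hup l)) j i
  rw [hz, hz] at h1
  have h2 := hcomp w (fun l => (hw l).le) i j
  have hwi := hpos w hw i
  have hwj := hpos w hw j
  have hvi := hpos v hv i
  have hvj := hpos v hv j
  have hE : 0 < E := Real.exp_pos h
  set a := (B.mulVec v) i
  set b := (B.mulVec v) j
  set x := (B.mulVec w) i
  set y := (B.mulVec w) j
  have hzj : 0 ≤ E * t * y - b := by
    rw [← hz j]
    simp only [Matrix.mulVec, dotProduct]
    exact Finset.sum_nonneg fun l _ => mul_nonneg (hB0 j l).le (sub_nonneg.2 (hup l))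
  have hK2 : 0 < K ^ 2 := by positivity
  have h3 : (K ^ 2)⁻¹ * ((E * t * y - b) * x) ≤ (E * t * x - a) * y := by
    rw [inv_mul_le_iff₀ hK2]
    calc (E * t * y - b) * x ≤ (E * t * y - b) * (K * y) := mul_le_mul_of_nonneg_left h2 hzj
      _ ≤ (K * (E * t * x - a)) * (K * y) := mul_le_mul_of_nonneg_right h1 (by positivity)
      _ = K ^ 2 * ((E * t * x - a) * y) := by ring
  have hs : (K ^ 2)⁻¹ ≤ 1 := inv_le_one_of_one_le₀ (one_le_pow₀ hK)
  set s := (K ^ 2)⁻¹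
  have h5 : 0 ≤ (1 - s) * E * x * (b - t * y) := by
    have : 0 ≤ b - t * y := sub_nonneg.2 hlowB
    have : 0 ≤ 1 - s := by linarith
    positivity
  nlinarith

/-! ### The norm of the cocycle -/

lemma cocycle_zero (M : Subshift A → Matrix (Fin d) (Fin d) ℝ) (x : Subshift A) :
    cocycle M 0 x = 1 := by simp [cocycle]

lemma cocycle_succ (M : Subshift A → Matrix (Fin d) (Fin d) ℝ) (n : ℕ) (x : Subshift A) :
    cocycle M (n + 1) x = M x * cocycle M n (shift x) := by
  simp [cocycle, List.range_succ_eq_map, Function.comp_def]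

lemma cocycle_add (M : Subshift A → Matrix (Fin d) (Fin d) ℝ) (n k : ℕ) (x : Subshift A) :
    cocycle M (n + k) x = cocycle M n x * cocycle M k (shift^[n] x) := by
  induction n generalizing x with
  | zero => simp [cocycle_zero]
  | succ n ih =>
    rw [Nat.add_right_comm, cocycle_succ, ih, cocycle_succ, mul_assoc, Function.iterate_succ_apply]

/-- The vector of row sums of the cocycle. -/
def rowSum (M : Subshift A → Matrix (Fin d) (Fin d) ℝ) (n : ℕ) (x : Subshift A) : Fin d → ℝ :=
  (cocycle M n x).mulVec 1

lemma rowSum_zero (M : Subshift A → Matrix (Fin d) (Fin d) ℝ) (x : Subshift A) :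
    rowSum M 0 x = 1 := by simp [rowSum, cocycle_zero]

lemma rowSum_succ (M : Subshift A → Matrix (Fin d) (Fin d) ℝ) (n : ℕ) (x : Subshift A) :
    rowSum M (n + 1) x = (M x).mulVec (rowSum M n (shift x)) := by
  rw [rowSum, cocycle_succ, ← Matrix.mulVec_mulVec, rowSum]

lemma entrySum_eq_sum_mulVec (B : Matrix (Fin d) (Fin d) ℝ) :
    entrySum B = ∑ i, B.mulVec 1 i := by
  simp [entrySum, Matrix.mulVec, dotProduct]

lemma entrySum_mul (B C : Matrix (Fin d) (Fin d) ℝ) :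
    entrySum (B * C) = ∑ k, (∑ i, B i k) * C.mulVec 1 k := by
  rw [entrySum_eq_sum_mulVec, ← Matrix.mulVec_mulVec]
  simp only [Matrix.mulVec, dotProduct, Finset.sum_mul]
  exact Finset.sum_comm

section Bounds

variable {M : Subshift A → Matrix (Fin d) (Fin d) ℝ} {K c τ : ℝ}

lemma cocycle_nonneg (hpos : ∀ x i j, 0 < M x i j) (n : ℕ) (x : Subshift A) (i j : Fin d) :
    0 ≤ cocycle M n x i j := by
  induction n generalizing x i with
  | zero => rw [cocycle_zero, Matrix.one_apply]; split_ifs <;> norm_num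
  | succ n ih =>
    rw [cocycle_succ, Matrix.mul_apply]
    exact Finset.sum_nonneg fun k _ => mul_nonneg (hpos x i k).le (ih _ _)

lemma rowSum_pos [NeZero d] (hpos : ∀ x i j, 0 < M x i j) (n : ℕ) (x : Subshift A) (i : Fin d) :
    0 < rowSum M n x i := by
  induction n generalizing x i with
  | zero => simp [rowSum_zero]
  | succ n ih =>
    rw [rowSum_succ]
    exact Finset.sum_pos (fun k _ => mul_pos (hpos x i k) (ih _ _)) ⟨(0 : Fin d), Finset.mem_univ _⟩

lemma entrySum_cocycle_pos [NeZero d] (hpos : ∀ x i j, 0 < M x i j) (n : ℕ) (x : Subshift A) :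
    0 < entrySum (cocycle M n x) := by
  rw [entrySum_eq_sum_mulVec]
  exact Finset.sum_pos (fun i _ => rowSum_pos hpos n x i) ⟨(0 : Fin d), Finset.mem_univ _⟩

lemma entry_le_mul_entry (hK : 1 ≤ K) (hMK : ∀ x i j, K⁻¹ ≤ M x i j ∧ M x i j ≤ K)
    (x : Subshift A) (i j k : Fin d) : M x i k ≤ K ^ 2 * M x j k := by
  have h1 := mul_le_mul_of_nonneg_left (hMK x j k).1 (by positivity : 0 ≤ K ^ 2)
  have h2 : K ^ 2 * K⁻¹ = K := by field_simp
  linarith [(hMK x i k).2]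

lemma rowSum_le_mul_rowSum [NeZero d] (hpos : ∀ x i j, 0 < M x i j) (hK : 1 ≤ K)
    (hMK : ∀ x i j, K⁻¹ ≤ M x i j ∧ M x i j ≤ K) (n : ℕ) (x : Subshift A) (i j : Fin d) :
    rowSum M n x i ≤ K ^ 2 * rowSum M n x j := by
  cases n with
  | zero =>
    simp only [rowSum_zero, Pi.one_apply, mul_one]
    exact one_le_pow₀ hK
  | succ n =>
    simp only [rowSum_succ, Matrix.mulVec, dotProduct, Finset.mul_sum]
    exact Finset.sum_le_sum fun l _ => by
      rw [← mul_assoc]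
      exact mul_le_mul_of_nonneg_right (entry_le_mul_entry hK hMK x i j l) (rowSum_pos hpos _ _ _).le

lemma mulVec_le_exp_mul {l : ℕ} (hlog : ∀ l x y, Agree l x y → ∀ i j,
      M x i j ≤ Real.exp (c * τ ^ l) * M y i j) {x y : Subshift A} (hxy : Agree l x y)
    {v : Fin d → ℝ} (hv : ∀ i, 0 < v i) (i : Fin d) :
    (M x).mulVec v i ≤ Real.exp (c * τ ^ l) * (M y).mulVec v i := by
  simp only [Matrix.mulVec, dotProduct, Finset.mul_sum]
  exact Finset.sum_le_sum fun k _ => by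
    rw [← mul_assoc]
    exact mul_le_mul_of_nonneg_right (hlog l x y hxy i k) (hv k).le

/-- One more matrix contracts the old projective distance by `ρ`, and replacing `M x` by `M y` adds
`2 c τ^(l+1)`. This recursion preserves a bound `C θ^l` whose constants do not depend on `n`. -/
lemma exists_rowSum_projClose [NeZero d] (hpos : ∀ x i j, 0 < M x i j) (hK : 1 ≤ K) (hc : 0 ≤ c)
    (hτ0 : 0 < τ) (hτ1 : τ < 1) (hMK : ∀ x i j, K⁻¹ ≤ M x i j ∧ M x i j ≤ K)
    (hlog : ∀ l x y, Agree l x y → ∀ i j, M x i j ≤ Real.exp (c * τ ^ l) * M y i j) :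
    ∃ C θ : ℝ, 0 ≤ C ∧ τ ≤ θ ∧ θ < 1 ∧ ∀ n l x y, Agree l x y →
      ProjClose (C * θ ^ l) (rowSum M n x) (rowSum M n y) := by
  set L := K ^ 2 with hL
  have hL1 : 1 ≤ L := one_le_pow₀ hK
  set H := 2 * Real.log L with hHdef
  have hH0 : 0 ≤ H := mul_nonneg zero_le_two (Real.log_nonneg hL1)
  have hexpH : Real.exp H = L * L := by
    rw [hHdef, two_mul, Real.exp_add, Real.exp_log (by linarith)]
  set δ := (L ^ 2)⁻¹ with hδ
  have hδ0 : 0 < δ := by positivity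
  have hδ1 : δ ≤ 1 := inv_le_one_of_one_le₀ (one_le_pow₀ hL1)
  set ρ := 1 - δ * Real.exp (-H) with hρ
  have hρ1 : ρ < 1 := by
    have : 0 < δ * Real.exp (-H) := by positivity
    linarith
  have hρ0 : 0 ≤ ρ := by
    have h1 : Real.exp (-H) ≤ 1 := Real.exp_le_one_iff.2 (by linarith)
    have : δ * Real.exp (-H) ≤ 1 := mul_le_one₀ hδ1 (Real.exp_pos _).le h1
    linarith
  -- The rate lies strictly above `ρ`, so that `ρ C + 2 c θ ≤ C θ` can be solved for `C`; the
  -- summand `H` in `C` settles `l = 0`.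
  set θ := max τ ((1 + ρ) / 2) with hθ
  have hτθ : τ ≤ θ := le_max_left _ _
  have hρθ : ρ < θ := lt_of_lt_of_le (by linarith) (le_max_right τ ((1 + ρ) / 2))
  have hθ1 : θ < 1 := max_lt hτ1 (by linarith)
  have hθ0 : 0 < θ := hτ0.trans_le hτθ
  set C := H + 2 * c * θ / (θ - ρ) with hC
  have hθρ : 0 < θ - ρ := by linarith
  have hC0 : 0 ≤ C := by positivity
  have hHC : H ≤ C := by
    have : 0 ≤ 2 * c * θ / (θ - ρ) := by positivity
    linarith
  have hrec : ρ * C + 2 * c * θ ≤ C * θ := by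
    have : 2 * c * θ ≤ C * (θ - ρ) := by
      rw [hC, add_mul, div_mul_cancel₀ _ hθρ.ne']
      have := mul_nonneg hH0 hθρ.le
      linarith
    linarith
  have hdiam : ∀ n x y, ProjClose H (rowSum M n x) (rowSum M n y) := fun n x y i j => by
    rw [hexpH]
    have h1 := rowSum_le_mul_rowSum hpos hK hMK n x i j
    have h2 := rowSum_le_mul_rowSum hpos hK hMK n y j i
    calc rowSum M n x i * rowSum M n y j
        ≤ (L * rowSum M n x j) * (L * rowSum M n y i) :=
          mul_le_mul h1 h2 (rowSum_pos hpos _ _ _).le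
            (mul_nonneg (by linarith) (rowSum_pos hpos _ _ _).le)
      _ = _ := by ring
  refine ⟨C, θ, hC0, hτθ, hθ1, fun n => ?_⟩
  induction n with
  | zero =>
    intro l x y _ i j
    simp only [rowSum_zero, Pi.one_apply, mul_one]
    exact Real.one_le_exp (by positivity)
  | succ n ih =>
    intro l x y hxy i j
    have hp : ∀ n x, ∀ i, 0 < rowSum M n x i := fun n x i => rowSum_pos hpos n x i
    cases l with
    | zero =>
      refine (hdiam (n + 1) x y i j).trans ?_
      rw [pow_zero, mul_one]
      exact mul_le_mul_of_nonneg_right (Real.exp_le_exp.2 hHC) (mul_pos (hp _ _ _) (hp _ _ _)).le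
    | succ l =>
      -- Capping at the projective diameter `H` keeps the contraction rate equal to `ρ`.
      set h := min (C * θ ^ l) H with hh
      have hclose : ProjClose h (rowSum M n (shift x)) (rowSum M n (shift y)) := by
        rcases min_choice (C * θ ^ l) H with h' | h' <;> rw [hh, h']
        · exact ih l _ _ hxy.shift
        · exact hdiam _ _ _
      have hcontr := hclose.mulVec hL1 (hpos x) (entry_le_mul_entry hK hMK x) (hp n _) (hp n _) i j
      have hle := one_add_mul_le_exp hδ0.le (le_min (by positivity) hH0 : 0 ≤ h)
        (min_le_right (C * θ ^ l) H)
      rw [← hρ] at hle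
      have hq1 := mulVec_le_exp_mul hlog hxy.symm (hp n (shift y)) j
      have hq2 := mulVec_le_exp_mul hlog hxy (hp n (shift y)) i
      simp only [rowSum_succ]
      have hpp : ∀ x y i, 0 < (M x).mulVec (rowSum M n y) i := fun x y i =>
        Finset.sum_pos (fun k _ => mul_pos (hpos x i k) (hp _ _ _)) ⟨(0 : Fin d), Finset.mem_univ _⟩
      set E := Real.exp (c * τ ^ (l + 1))
      calc (M x).mulVec (rowSum M n (shift x)) i * (M y).mulVec (rowSum M n (shift y)) j
          ≤ (M x).mulVec (rowSum M n (shift x)) i * (E * (M x).mulVec (rowSum M n (shift y)) j) :=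
            mul_le_mul_of_nonneg_left hq1 (hpp _ _ _).le
        _ = E * ((M x).mulVec (rowSum M n (shift x)) i *
              (M x).mulVec (rowSum M n (shift y)) j) := by ring
        _ ≤ E * (Real.exp (ρ * h) * ((M x).mulVec (rowSum M n (shift x)) j *
              (M x).mulVec (rowSum M n (shift y)) i)) := by
            refine mul_le_mul_of_nonneg_left (hcontr.trans ?_) (Real.exp_pos _).le
            exact mul_le_mul_of_nonneg_right hle (mul_pos (hpp _ _ _) (hpp _ _ _)).le
        _ ≤ E * (Real.exp (ρ * h) * ((M x).mulVec (rowSum M n (shift x)) j *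
              (E * (M y).mulVec (rowSum M n (shift y)) i))) := by
            have := (hpp x (shift x) j).le
            gcongr
        _ = Real.exp (c * τ ^ (l + 1) + c * τ ^ (l + 1) + ρ * h) *
              ((M x).mulVec (rowSum M n (shift x)) j *
              (M y).mulVec (rowSum M n (shift y)) i) := by
            rw [Real.exp_add, Real.exp_add]; ring
        _ ≤ _ := by
            refine mul_le_mul_of_nonneg_right (Real.exp_le_exp.2 ?_)
              (mul_pos (hpp _ _ _) (hpp _ _ _)).le
            have h1 : ρ * h ≤ ρ * (C * θ ^ l) := mul_le_mul_of_nonneg_left (min_le_left _ _) hρ0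
            have h2 : c * τ ^ (l + 1) ≤ c * θ ^ (l + 1) :=
              mul_le_mul_of_nonneg_left (pow_le_pow_left₀ hτ0.le hτθ _) hc
            have h3 := mul_le_mul_of_nonneg_right hrec (pow_pos hθ0 l).le
            rw [pow_succ θ] at h2 ⊢
            linarith

end Bounds

/-- The logarithm of the norm of the cocycle. -/
def logNorm (M : Subshift A → Matrix (Fin d) (Fin d) ℝ) (n : ℕ) (x : Subshift A) : ℝ :=
  Real.log (entrySum (cocycle M n x))

/-- The increment `log (‖M(x) ⋯ M(σⁿ x)‖ / ‖M(σ x) ⋯ M(σⁿ x)‖)`. -/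
def logIncr (M : Subshift A → Matrix (Fin d) (Fin d) ℝ) (n : ℕ) (x : Subshift A) : ℝ :=
  logNorm M (n + 1) x - logNorm M n (shift x)

lemma abs_log_sub_log_le {a b C : ℝ} (ha : 0 < a) (hb : 0 < b) (h1 : a ≤ Real.exp C * b)
    (h2 : b ≤ Real.exp C * a) : |Real.log a - Real.log b| ≤ C := by
  have e1 := Real.log_le_log ha h1
  have e2 := Real.log_le_log hb h2
  rw [Real.log_mul (Real.exp_pos _).ne' (by positivity), Real.log_exp] at e1 e2
  rw [abs_le]
  constructor <;> linarith

/-- `b` is bounded by `β` and Hölder continuous with constant `β` and rate `θ`. -/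
structure HolderBound (β θ : ℝ) (b : Subshift A → ℝ) : Prop where
  abs_le : ∀ x, |b x| ≤ β
  abs_sub_le : ∀ l x y, Agree l x y → |b x - b y| ≤ β * θ ^ l

theorem exists_logNorm_bounds [NeZero d] (hm : 2 ≤ m) {M : Subshift A → Matrix (Fin d) (Fin d) ℝ}
    (hM : IsHolder M) (hpos : ∀ x i j, 0 < M x i j) :
    ∃ β θ : ℝ, 0 ≤ β ∧ 0 < θ ∧ θ < 1 ∧ (∀ n, HolderBound β θ (logIncr M n)) ∧
      ∀ n k x, |logNorm M (n + k) x - (logNorm M n x + logNorm M k (shift^[n] x))| ≤ β := by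
  obtain ⟨K, c, τ, hK, hc, hτ0, hτ1, hMK, hlog⟩ := hM.exists_entry_bounds hm hpos
  obtain ⟨C, θ, hC, hτθ, hθ1, hclose⟩ := exists_rowSum_projClose hpos hK hc hτ0 hτ1 hMK hlog
  have hθ0 := hτ0.trans_le hτθ
  have hd1 : (1 : ℝ) ≤ d := by exact_mod_cast NeZero.one_le
  have hd0 : (0 : ℝ) < d := by linarith
  have hp : ∀ n x, ∀ i, 0 < rowSum M n x i := fun n x i => rowSum_pos hpos n x i
  have hS := entrySum_cocycle_pos (d := d) hpos
  set D := Real.log (d * K ^ 2) with hD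
  have hdK : 1 ≤ d * K ^ 2 := one_le_mul_of_one_le_of_one_le hd1 (one_le_pow₀ hK)
  have hD0 : 0 ≤ D := Real.log_nonneg hdK
  have hexpD : Real.exp D = d * K ^ 2 := Real.exp_log (by linarith)
  have hrow : ∀ n x, entrySum (cocycle M n x) = ∑ i, rowSum M n x i := fun n x =>
    entrySum_eq_sum_mulVec _
  have hsucc : ∀ n x, entrySum (cocycle M (n + 1) x)
      = ∑ k, (∑ i, M x i k) * rowSum M n (shift x) k := fun n x => by
    rw [cocycle_succ, entrySum_mul]; rfl
  have hbdd : ∀ n x, |logIncr M n x| ≤ D := by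
    intro n x
    refine abs_log_sub_log_le (hS _ _) (hS _ _) ?_ ?_
    · rw [hsucc, hrow, Finset.mul_sum, hexpD]
      refine Finset.sum_le_sum fun k _ => mul_le_mul_of_nonneg_right ?_ (hp _ _ _).le
      calc ∑ i, M x i k ≤ ∑ _i : Fin d, K := Finset.sum_le_sum fun i _ => (hMK x i k).2
        _ = d * K := by simp
        _ ≤ d * K ^ 2 := by nlinarith
    · rw [hsucc, hrow, Finset.mul_sum, hexpD]
      refine Finset.sum_le_sum fun k _ => ?_
      rw [← mul_assoc]
      refine le_mul_of_one_le_left (hp _ _ _).le ?_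
      have h1 : K⁻¹ ≤ ∑ i, M x i k := (hMK x 0 k).1.trans
        (Finset.single_le_sum (f := fun i => M x i k) (fun i _ => (hpos x i k).le)
          (Finset.mem_univ 0))
      calc (1 : ℝ) = K * K⁻¹ := (mul_inv_cancel₀ (by linarith)).symm
        _ ≤ (d * K ^ 2) * ∑ i, M x i k := by
          refine mul_le_mul ?_ h1 (by positivity) (by positivity)
          nlinarith
  -- After cross-multiplication only products of a row sum at `shift x` and one at `shift y` occur,
  -- and projective closeness compares exactly these.
  have hhol : ∀ n l x y, Agree (l + 1) x y →
      entrySum (cocycle M (n + 1) x) * entrySum (cocycle M n (shift y)) ≤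
        Real.exp (C * θ ^ l + c * τ ^ (l + 1)) *
          (entrySum (cocycle M (n + 1) y) * entrySum (cocycle M n (shift x))) := by
    intro n l x y hxy
    rw [hsucc, hsucc, hrow, hrow, Finset.sum_mul_sum, Finset.sum_mul_sum, Finset.mul_sum]
    refine Finset.sum_le_sum fun k _ => ?_
    rw [Finset.mul_sum]
    refine Finset.sum_le_sum fun j _ => ?_
    have h1 : ∑ i, M x i k ≤ Real.exp (c * τ ^ (l + 1)) * ∑ i, M y i k := by
      rw [Finset.mul_sum]
      exact Finset.sum_le_sum fun i _ => hlog _ x y hxy i k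
    have h2 := hclose n l _ _ hxy.shift k j
    rw [Real.exp_add]
    calc (∑ i, M x i k) * rowSum M n (shift x) k * rowSum M n (shift y) j
        = (∑ i, M x i k) * (rowSum M n (shift x) k * rowSum M n (shift y) j) := by ring
      _ ≤ (Real.exp (c * τ ^ (l + 1)) * ∑ i, M y i k) *
          (Real.exp (C * θ ^ l) * (rowSum M n (shift x) j * rowSum M n (shift y) k)) := by
          refine mul_le_mul h1 h2 (mul_pos (hp _ _ _) (hp _ _ _)).le ?_
          exact mul_nonneg (Real.exp_pos _).le (Finset.sum_nonneg fun i _ => (hpos y i k).le)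
      _ = _ := by ring
  -- The summand `2 * D` covers points with no guaranteed agreement; `C / θ` pays for the symbol
  -- lost under the shift.
  refine ⟨2 * D + (C / θ + c), θ, by positivity, hθ0, hθ1, fun n => ⟨fun x => ?_, ?_⟩, ?_⟩
  · have : 0 ≤ C / θ + c := by positivity
    linarith [hbdd n x]
  · intro l x y hxy
    cases l with
    | zero =>
      have h1 := abs_sub (logIncr M n x) (logIncr M n y)
      have : 0 ≤ C / θ + c := by positivity
      rw [pow_zero]
      linarith [hbdd n x, hbdd n y]
    | succ l =>
      have h1 := abs_log_sub_log_le (mul_pos (hS (n + 1) x) (hS n (shift y)))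
        (mul_pos (hS (n + 1) y) (hS n (shift x))) (hhol n l x y hxy) (hhol n l y x hxy.symm)
      rw [Real.log_mul (hS _ _).ne' (hS _ _).ne', Real.log_mul (hS _ _).ne' (hS _ _).ne'] at h1
      have h2 : C * θ ^ l + c * τ ^ (l + 1) ≤ (C / θ + c) * θ ^ (l + 1) := by
        have h3 : c * τ ^ (l + 1) ≤ c * θ ^ (l + 1) :=
          mul_le_mul_of_nonneg_left (pow_le_pow_left₀ hτ0.le hτθ _) hc
        have h4 : C * θ ^ l = C / θ * θ ^ (l + 1) := by field_simp; ring
        linarith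
      have h5 : 0 ≤ 2 * D * θ ^ (l + 1) := by positivity
      calc |logIncr M n x - logIncr M n y| = |logNorm M (n + 1) x + logNorm M n (shift y) -
            (logNorm M (n + 1) y + logNorm M n (shift x))| := by
            rw [logIncr, logIncr]; congr 1; ring
        _ ≤ C * θ ^ l + c * τ ^ (l + 1) := h1
        _ ≤ _ := by linarith
  · intro n k x
    have hPn := cocycle_nonneg hpos n x
    have h1 := abs_log_sub_log_le (C := D) (hS (n + k) x)
      (mul_pos (hS n x) (hS k (shift^[n] x))) ?_ ?_
    · rw [Real.log_mul (hS _ _).ne' (hS _ _).ne'] at h1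
      have : 0 ≤ C / θ + c := by positivity
      exact h1.trans (by linarith)
    all_goals
      have hcol : entrySum (cocycle M n x) = ∑ l, ∑ i, cocycle M n x i l := Finset.sum_comm
      rw [cocycle_add, entrySum_mul, hcol, hexpD, Finset.sum_mul, Finset.mul_sum]
      refine Finset.sum_le_sum fun l _ => ?_
      have hcn : 0 ≤ ∑ i, cocycle M n x i l := Finset.sum_nonneg fun i _ => hPn i l
    · calc (∑ i, cocycle M n x i l) * rowSum M k (shift^[n] x) l
          ≤ (∑ i, cocycle M n x i l) * entrySum (cocycle M k (shift^[n] x)) := by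
            refine mul_le_mul_of_nonneg_left ?_ hcn
            rw [hrow]
            exact Finset.single_le_sum (fun i _ => (hp _ _ i).le) (Finset.mem_univ l)
        _ ≤ _ := le_mul_of_one_le_left (mul_nonneg hcn (hS _ _).le) hdK
    · have h2 : entrySum (cocycle M k (shift^[n] x)) ≤
          d * K ^ 2 * rowSum M k (shift^[n] x) l := by
        rw [hrow]
        calc ∑ i, rowSum M k (shift^[n] x) i
            ≤ ∑ _i : Fin d, K ^ 2 * rowSum M k (shift^[n] x) l :=
              Finset.sum_le_sum fun i _ => rowSum_le_mul_rowSum hpos hK hMK k _ i l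
          _ = _ := by simp; ring
      calc (∑ i, cocycle M n x i l) * entrySum (cocycle M k (shift^[n] x))
          ≤ (∑ i, cocycle M n x i l) * (d * K ^ 2 * rowSum M k (shift^[n] x) l) :=
            mul_le_mul_of_nonneg_left h2 hcn
        _ = _ := by rw [rowSum]; ring

/-! ### Preimages under the shift -/

open Classical in
/-- The symbols that may precede `x`. -/
def pred (x : Subshift A) : Finset (Fin m) := Finset.univ.filter fun a => A a (x.1 0) = 1

/-- The point `a x`, when `a` may precede `x`. -/
def consPoint (a : Fin m) (x : Subshift A) (h : A a (x.1 0) = 1) : Subshift A :=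
  ⟨fun k => Nat.casesOn k a x.1, fun k => by cases k with
    | zero => exact h
    | succ k => exact x.2 k⟩

open Classical in
/-- The point `a x` if `a ∈ pred x`, and `x` otherwise. -/
def prepend (a : Fin m) (x : Subshift A) : Subshift A :=
  if h : A a (x.1 0) = 1 then consPoint a x h else x

lemma mem_pred {a : Fin m} {x : Subshift A} : a ∈ pred x ↔ A a (x.1 0) = 1 := by simp [pred]

lemma prepend_val_zero {a : Fin m} {x : Subshift A} (h : a ∈ pred x) : (prepend a x).1 0 = a := by
  rw [prepend, dif_pos (mem_pred.1 h)]; rfl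

lemma prepend_val_succ {a : Fin m} {x : Subshift A} (h : a ∈ pred x) (k : ℕ) :
    (prepend a x).1 (k + 1) = x.1 k := by
  rw [prepend, dif_pos (mem_pred.1 h)]; rfl

lemma shift_prepend {a : Fin m} {x : Subshift A} (h : a ∈ pred x) : shift (prepend a x) = x :=
  Subtype.ext (funext fun k => prepend_val_succ h k)

lemma head_mem_pred (y : Subshift A) : y.1 0 ∈ pred (shift y) := mem_pred.2 (y.2 0)

lemma prepend_shift (y : Subshift A) : prepend (y.1 0) (shift y) = y := by
  refine Subtype.ext (funext fun k => ?_)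
  cases k with
  | zero => exact prepend_val_zero (head_mem_pred y)
  | succ k => exact prepend_val_succ (head_mem_pred y) k

lemma Agree.pred_eq {l : ℕ} {x y : Subshift A} (h : Agree (l + 1) x y) : pred x = pred y := by
  rw [pred, pred, h 0 (Nat.succ_pos l)]

lemma Agree.prepend {l : ℕ} {x y : Subshift A} (h : Agree l x y) {a : Fin m} (hx : a ∈ pred x)
    (hy : a ∈ pred y) : Agree (l + 1) (prepend a x) (prepend a y) := fun i hi => by
  cases i with
  | zero => rw [prepend_val_zero hx, prepend_val_zero hy]
  | succ i => rw [prepend_val_succ hx, prepend_val_succ hy]; exact h i (by omega)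

/-- Every point has preimages of order `p` starting with any given symbol. -/
def Mixing (A : Matrix (Fin m) (Fin m) ℝ) (p : ℕ) : Prop :=
  0 < p ∧ ∀ (a : Fin m) (x : Subshift A), ∃ y : Subshift A, y.1 0 = a ∧ shift^[p] y = x

lemma exists_preimage_of_pow_pos (hA01 : ∀ i j, A i j = 0 ∨ A i j = 1) (k : ℕ) (a : Fin m)
    (x : Subshift A) (h : 0 < (A ^ k) a (x.1 0)) :
    ∃ y : Subshift A, y.1 0 = a ∧ shift^[k] y = x := by
  induction k generalizing a with
  | zero =>
    rw [pow_zero, Matrix.one_apply] at h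
    split_ifs at h with hax
    · exact ⟨x, hax.symm, rfl⟩
    · exact absurd h (lt_irrefl _)
  | succ k ih =>
    rw [pow_succ', Matrix.mul_apply] at h
    obtain ⟨l, -, hl⟩ := Finset.exists_lt_of_sum_lt (f := fun _ => (0 : ℝ)) (by simpa using h)
    rcases hA01 a l with h0 | h1
    · simp [h0] at hl
    · rw [h1, one_mul] at hl
      obtain ⟨y, hy0, hy⟩ := ih l hl
      have ha : a ∈ pred y := mem_pred.2 (by rw [hy0, h1])
      exact ⟨prepend a y, prepend_val_zero ha, by
        rw [Function.iterate_succ_apply, shift_prepend ha, hy]⟩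

lemma exists_mixing (hA01 : ∀ i j, A i j = 0 ∨ A i j = 1) (hA : A.IsPrimitive) :
    ∃ p, Mixing A p := by
  obtain ⟨p, hp, hpos⟩ := hA.exists_pos_pow
  exact ⟨p, hp, fun a x => exists_preimage_of_pow_pos hA01 p a x (hpos _ _)⟩

lemma exists_succ (hA01 : ∀ i j, A i j = 0 ∨ A i j = 1) (hA : A.IsPrimitive) (a : Fin m) :
    ∃ b, A a b = 1 := by
  obtain ⟨p, hp, hpos⟩ := hA.exists_pos_pow
  obtain ⟨k, rfl⟩ := Nat.exists_eq_succ_of_ne_zero hp.ne'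
  have h := hpos a a
  rw [pow_succ', Matrix.mul_apply] at h
  obtain ⟨l, -, hl⟩ := Finset.exists_lt_of_sum_lt (f := fun _ => (0 : ℝ)) (by simpa using h)
  rcases hA01 a l with h0 | h1
  · simp [h0] at hl
  · exact ⟨l, h1⟩

lemma exists_point (hA01 : ∀ i j, A i j = 0 ∨ A i j = 1) (hA : A.IsPrimitive) (a : Fin m) :
    ∃ x : Subshift A, x.1 0 = a := by
  choose s hs using exists_succ hA01 hA
  refine ⟨⟨fun k => s^[k] a, fun k => ?_⟩, rfl⟩
  change A (s^[k] a) (s^[k + 1] a) = 1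
  rw [Function.iterate_succ_apply']
  exact hs _

lemma Mixing.pred_nonempty [NeZero m] {p : ℕ} (h : Mixing A p) (x : Subshift A) :
    (pred x).Nonempty := by
  obtain ⟨y, -, hy⟩ := h.2 0 x
  obtain ⟨k, rfl⟩ := Nat.exists_eq_succ_of_ne_zero h.1.ne'
  rw [Function.iterate_succ_apply'] at hy
  exact ⟨_, hy ▸ head_mem_pred (shift^[k] y)⟩

/-- The source of coupling: mixing supplies a common first symbol, and points with the same first
symbol have the same predecessors, so common symbols can be prepended indefinitely. -/
lemma Mixing.exists_agree [NeZero m] {p : ℕ} (h : Mixing A p) (r : ℕ) (x y : Subshift A) :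
    ∃ x' y' : Subshift A, Agree (r + 1) x' y' ∧ shift^[p + r] x' = x ∧ shift^[p + r] y' = y := by
  induction r with
  | zero =>
    obtain ⟨x', hx0, hx⟩ := h.2 0 x
    obtain ⟨y', hy0, hy⟩ := h.2 0 y
    refine ⟨x', y', fun i hi => ?_, hx, hy⟩
    obtain rfl : i = 0 := by omega
    rw [hx0, hy0]
  | succ r ih =>
    obtain ⟨x', y', hxy, hx, hy⟩ := ih
    obtain ⟨a, ha⟩ := h.pred_nonempty x'
    have hb : a ∈ pred y' := hxy.pred_eq ▸ ha
    refine ⟨prepend a x', prepend a y', hxy.prepend ha hb, ?_, ?_⟩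
    · rw [← add_assoc, Function.iterate_succ_apply, shift_prepend ha, hx]
    · rw [← add_assoc, Function.iterate_succ_apply, shift_prepend hb, hy]

/-! ### Logarithms of sums of exponentials -/

section LogSumExp

variable {ι : Type*} {s : Finset ι}

lemma log_sum_exp_le_add (hs : s.Nonempty) {f g : ι → ℝ} {C : ℝ} (h : ∀ i ∈ s, f i ≤ g i + C) :
    Real.log (∑ i ∈ s, Real.exp (f i)) ≤ Real.log (∑ i ∈ s, Real.exp (g i)) + C := by
  have hg : 0 < ∑ i ∈ s, Real.exp (g i) := Finset.sum_pos (fun i _ => Real.exp_pos _) hs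
  have hf : 0 < ∑ i ∈ s, Real.exp (f i) := Finset.sum_pos (fun i _ => Real.exp_pos _) hs
  rw [Real.log_le_iff_le_exp hf, Real.exp_add, Real.exp_log hg, Finset.sum_mul]
  exact Finset.sum_le_sum fun i hi => by
    rw [← Real.exp_add]; exact Real.exp_le_exp.2 (h i hi)

lemma le_log_sum_exp {f : ι → ℝ} {i : ι} (hi : i ∈ s) :
    f i ≤ Real.log (∑ i ∈ s, Real.exp (f i)) := by
  have hf : 0 < ∑ i ∈ s, Real.exp (f i) := Finset.sum_pos (fun i _ => Real.exp_pos _) ⟨i, hi⟩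
  rw [Real.le_log_iff_exp_le hf]
  exact Finset.single_le_sum (f := fun i => Real.exp (f i)) (fun i _ => (Real.exp_pos _).le) hi

lemma exists_log_sum_exp_le (hs : s.Nonempty) (f : ι → ℝ) :
    ∃ i ∈ s, Real.log (∑ i ∈ s, Real.exp (f i)) ≤ Real.log s.card + f i := by
  obtain ⟨i, hi, hmax⟩ := Finset.exists_max_image s f hs
  refine ⟨i, hi, ?_⟩
  have hf : 0 < ∑ i ∈ s, Real.exp (f i) := Finset.sum_pos (fun i _ => Real.exp_pos _) hs
  have hc : (0 : ℝ) < s.card := by exact_mod_cast hs.card_pos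
  rw [Real.log_le_iff_le_exp hf, Real.exp_add, Real.exp_log hc]
  calc ∑ i ∈ s, Real.exp (f i) ≤ ∑ _j ∈ s, Real.exp (f i) :=
        Finset.sum_le_sum fun j hj => Real.exp_le_exp.2 (hmax j hj)
    _ = _ := by simp

lemma sum_exp_sub_log_sum_exp (hs : s.Nonempty) (f : ι → ℝ) :
    ∑ i ∈ s, Real.exp (f i - Real.log (∑ j ∈ s, Real.exp (f j))) = 1 := by
  have hf : 0 < ∑ i ∈ s, Real.exp (f i) := Finset.sum_pos (fun i _ => Real.exp_pos _) hs
  simp only [Real.exp_sub, Real.exp_log hf, ← Finset.sum_div]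
  exact div_self hf.ne'

lemma hasDerivAt_log_sum_exp (hs : s.Nonempty) {f : ι → ℝ → ℝ} {f' : ι → ℝ} {q : ℝ}
    (h : ∀ i ∈ s, HasDerivAt (f i) (f' i) q) :
    HasDerivAt (fun t => Real.log (∑ i ∈ s, Real.exp (f i t)))
      (∑ i ∈ s, Real.exp (f i q - Real.log (∑ j ∈ s, Real.exp (f j q))) * f' i) q := by
  have hf : 0 < ∑ i ∈ s, Real.exp (f i q) := Finset.sum_pos (fun i _ => Real.exp_pos _) hs
  have h1 := (HasDerivAt.fun_sum fun i hi => (h i hi).exp).log hf.ne'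
  convert h1 using 1
  rw [Finset.sum_div]
  refine Finset.sum_congr rfl fun i _ => ?_
  rw [Real.exp_sub, Real.exp_log hf]
  ring

/-- Both weights have total mass one, so centring `f'` at `c` is free, and a change of weights costs
only the oscillation of `f'`, not its size. -/
lemma sum_sub_sum_le_of_close {w w' f f' : ι → ℝ} {η ζ O c : ℝ}
    (hw : ∀ i ∈ s, 0 ≤ w i) (hw1 : ∑ i ∈ s, w i = 1) (hw'1 : ∑ i ∈ s, w' i = 1)
    (hf : ∀ i ∈ s, f i - f' i ≤ η) (hww : ∀ i ∈ s, |w i - w' i| ≤ ζ * w' i)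
    (hO : ∀ i ∈ s, |f' i - c| ≤ O) :
    ∑ i ∈ s, w i * f i - ∑ i ∈ s, w' i * f' i ≤ η + ζ * O := by
  have h1 : ∑ i ∈ s, w i * f i - ∑ i ∈ s, w' i * f' i =
      ∑ i ∈ s, (w i * (f i - f' i) + (w i - w' i) * (f' i - c)) := by
    have e : ∀ i, w i * (f i - f' i) + (w i - w' i) * (f' i - c) =
        w i * f i - w' i * f' i - w i * c + w' i * c := fun i => by ring
    simp only [e, Finset.sum_add_distrib, Finset.sum_sub_distrib, ← Finset.sum_mul, hw1, hw'1]
    ring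
  have h2 : ∑ i ∈ s, (w i * η + ζ * w' i * O) = η + ζ * O := by
    rw [Finset.sum_add_distrib, ← Finset.sum_mul, hw1, ← Finset.sum_mul, ← Finset.mul_sum, hw'1]
    ring
  rw [h1, ← h2]
  refine Finset.sum_le_sum fun i hi => add_le_add (mul_le_mul_of_nonneg_left (hf i hi) (hw i hi)) ?_
  refine (le_abs_self _).trans ?_
  rw [abs_mul]
  exact mul_le_mul (hww i hi) (hO i hi) (abs_nonneg _) ((abs_nonneg _).trans (hww i hi))

/-- Two weighted averages of functions whose values are pairwise within `O`: if one pair of values,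
of weight at least `δ²`, differs by at most `O - ε`, then the averages differ by at most
`O - δ² ε`. -/
lemma sum_sub_sum_le_of_pair {κ : Type*} {t : Finset κ} {w f : ι → ℝ} {w' f' : κ → ℝ} {O δ ε : ℝ}
    (hw : ∀ i ∈ s, 0 ≤ w i) (hw1 : ∑ i ∈ s, w i = 1) (hw' : ∀ i ∈ t, 0 ≤ w' i)
    (hw'1 : ∑ i ∈ t, w' i = 1) (hO : ∀ i ∈ s, ∀ j ∈ t, f i - f' j ≤ O) {i₀ : ι} {j₀ : κ}
    (hi : i₀ ∈ s) (hj : j₀ ∈ t) (hδ : 0 ≤ δ) (hwi : δ ≤ w i₀) (hwj : δ ≤ w' j₀) (hε : 0 ≤ ε)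
    (hpair : f i₀ - f' j₀ ≤ O - ε) :
    ∑ i ∈ s, w i * f i - ∑ j ∈ t, w' j * f' j ≤ O - δ ^ 2 * ε := by
  have hnn : ∀ i ∈ s, ∀ j ∈ t, 0 ≤ w i * w' j * (O - (f i - f' j)) := fun i hi j hj =>
    mul_nonneg (mul_nonneg (hw i hi) (hw' j hj)) (by linarith [hO i hi j hj])
  have h1 : w i₀ * w' j₀ * (O - (f i₀ - f' j₀)) ≤
      ∑ i ∈ s, ∑ j ∈ t, w i * w' j * (O - (f i - f' j)) :=
    (Finset.single_le_sum (f := fun j => w i₀ * w' j * (O - (f i₀ - f' j)))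
      (hnn i₀ hi) hj).trans
      (Finset.single_le_sum (f := fun i => ∑ j ∈ t, w i * w' j * (O - (f i - f' j)))
        (fun i hi => Finset.sum_nonneg (hnn i hi)) hi)
  have h2 : ∑ i ∈ s, ∑ j ∈ t, w i * w' j * (O - (f i - f' j)) =
      O - (∑ i ∈ s, w i * f i - ∑ j ∈ t, w' j * f' j) := by
    have e : ∀ i j, w i * w' j * (O - (f i - f' j)) =
        w i * w' j * O - (w i * f i) * w' j + w i * (w' j * f' j) := fun i j => by ring
    simp only [e, Finset.sum_add_distrib, Finset.sum_sub_distrib, ← Finset.sum_mul,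
      ← Finset.mul_sum, hw'1, hw1]
    ring
  have h3 : δ ^ 2 * ε ≤ w i₀ * w' j₀ * (O - (f i₀ - f' j₀)) := by
    rw [sq]
    exact mul_le_mul (mul_le_mul hwi hwj hδ (hw _ hi)) (by linarith) hε
      (mul_nonneg (hw _ hi) (hw' _ hj))
  linarith

end LogSumExp

/-! ### Iterated transfer operators -/

/-- The logarithm of `∑ exp (q ∑_{j < k} b_j (σʲ y))`, the sum being over the points `y` with
`σᵏ y = x`. -/
def logPartition (b : ℕ → Subshift A → ℝ) : ℕ → ℝ → Subshift A → ℝ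
  | 0, _, _ => 0
  | k + 1, q, x => Real.log (∑ a ∈ pred x,
      Real.exp (q * b k (prepend a x) + logPartition b k q (prepend a x)))

/-- The transition probability from `x` to its preimage `a x`. -/
def weight (b : ℕ → Subshift A → ℝ) (k : ℕ) (q : ℝ) (x : Subshift A) (a : Fin m) : ℝ :=
  Real.exp (q * b k (prepend a x) + logPartition b k q (prepend a x) - logPartition b (k + 1) q x)

/-- The derivative of `logPartition` in `q`. -/
def meanEnergy (b : ℕ → Subshift A → ℝ) : ℕ → ℝ → Subshift A → ℝ
  | 0, _, _ => 0
  | k + 1, q, x => ∑ a ∈ pred x,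
      weight b k q x a * (b k (prepend a x) + meanEnergy b k q (prepend a x))

/-- The second derivative of `logPartition` in `q`. -/
def energyVar (b : ℕ → Subshift A → ℝ) : ℕ → ℝ → Subshift A → ℝ
  | 0, _, _ => 0
  | k + 1, q, x => ∑ a ∈ pred x, weight b k q x a *
      ((b k (prepend a x) + meanEnergy b k q (prepend a x) - meanEnergy b (k + 1) q x) *
        (b k (prepend a x) + meanEnergy b k q (prepend a x)) + energyVar b k q (prepend a x))

/-- Uniformly Hölder continuous potentials on a mixing subshift. -/
structure Regular (b : ℕ → Subshift A → ℝ) (β θ : ℝ) (p : ℕ) : Prop where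
  nonneg : 0 ≤ β
  rate_pos : 0 < θ
  rate_lt_one : θ < 1
  mixing : Mixing A p
  holder : ∀ k, HolderBound β θ (b k)

section

variable {b : ℕ → Subshift A → ℝ} {β θ Q q : ℝ} {p : ℕ}

lemma weight_pos (k : ℕ) (q : ℝ) (x : Subshift A) (a : Fin m) : 0 < weight b k q x a :=
  Real.exp_pos _

lemma Regular.abs_mul_sub_le (h : Regular b β θ p) (hq : |q| ≤ Q) {l : ℕ} {x y : Subshift A}
    (hxy : Agree l x y) (k : ℕ) : |q * b k x - q * b k y| ≤ Q * β * θ ^ l := by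
  rw [← mul_sub, abs_mul, mul_assoc]
  exact mul_le_mul hq ((h.holder k).abs_sub_le l x y hxy) (abs_nonneg _) ((abs_nonneg q).trans hq)

lemma Regular.abs_mul_le (h : Regular b β θ p) (hq : |q| ≤ Q) (k : ℕ) (x : Subshift A) :
    |q * b k x| ≤ Q * β := by
  rw [abs_mul]
  exact mul_le_mul hq ((h.holder k).abs_le x) (abs_nonneg _) ((abs_nonneg q).trans hq)

lemma HolderBound.sub_le {f : Subshift A → ℝ} (h : HolderBound β θ f) (x y : Subshift A) :
    f x - f y ≤ 2 * β := by
  linarith [le_of_abs_le (h.abs_le x), neg_le_of_abs_le (h.abs_le y)]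

lemma Regular.le_logPartition_shift (h : Regular b β θ p) (hq : |q| ≤ Q) (k : ℕ)
    (y : Subshift A) : logPartition b k q y - Q * β ≤ logPartition b (k + 1) q (shift y) := by
  have h1 := le_log_sum_exp (f := fun a => q * b k (prepend a (shift y)) +
    logPartition b k q (prepend a (shift y))) (head_mem_pred y)
  simp only [prepend_shift] at h1
  have h2 := neg_le_of_abs_le (h.abs_mul_le hq k y)
  simp only [logPartition] at h1 ⊢
  linarith

lemma Regular.le_logPartition_iterate (h : Regular b β θ p) (hq : |q| ≤ Q) (k j : ℕ)
    (y : Subshift A) :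
    logPartition b k q y - j * (Q * β) ≤ logPartition b (k + j) q (shift^[j] y) := by
  induction j with
  | zero => simp
  | succ j ih =>
    have := h.le_logPartition_shift hq (k + j) (shift^[j] y)
    rw [Function.iterate_succ_apply', ← add_assoc]
    push_cast
    linarith

variable [NeZero m]

lemma sum_weight (hA : Mixing A p) (k : ℕ) (q : ℝ) (x : Subshift A) :
    ∑ a ∈ pred x, weight b k q x a = 1 :=
  sum_exp_sub_log_sum_exp (hA.pred_nonempty x) _

lemma hasDerivAt_logPartition (hA : Mixing A p) (k : ℕ) (q : ℝ) (x : Subshift A) :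
    HasDerivAt (fun t => logPartition b k t x) (meanEnergy b k q x) q := by
  induction k generalizing x with
  | zero => exact hasDerivAt_const q 0
  | succ k ih =>
    refine hasDerivAt_log_sum_exp (hA.pred_nonempty x) fun a _ => ?_
    simpa using ((hasDerivAt_id q).mul_const (b k (prepend a x))).fun_add (ih (prepend a x))

lemma hasDerivAt_meanEnergy (hA : Mixing A p) (k : ℕ) (q : ℝ) (x : Subshift A) :
    HasDerivAt (fun t => meanEnergy b k t x) (energyVar b k q x) q := by
  induction k generalizing x with
  | zero => exact hasDerivAt_const q 0
  | succ k ih =>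
    refine HasDerivAt.fun_sum fun a _ => ?_
    have h1 : HasDerivAt (fun t => weight b k t x a) (weight b k q x a *
        (b k (prepend a x) + meanEnergy b k q (prepend a x) - meanEnergy b (k + 1) q x)) q := by
      refine HasDerivAt.exp ?_
      simpa using (((hasDerivAt_id q).mul_const (b k (prepend a x))).fun_add
        (hasDerivAt_logPartition hA k q (prepend a x))).fun_sub (hasDerivAt_logPartition hA (k + 1) q x)
    exact (h1.fun_mul ((ih (prepend a x)).const_add (b k (prepend a x)))).congr_deriv (by ring)

/-- Each prepended symbol lengthens the agreement, so the errors form a geometric series. One common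
symbol is required for the two sums to run over the same predecessors. -/
lemma Regular.logPartition_le_add (h : Regular b β θ p) (hq : |q| ≤ Q) (k l : ℕ)
    {x y : Subshift A} (hxy : Agree (l + 1) x y) :
    logPartition b k q x ≤ logPartition b k q y + Q * β / (1 - θ) * θ ^ (l + 1) := by
  have hθ := h.rate_pos
  have hθ1 : 0 < 1 - θ := sub_pos.2 h.rate_lt_one
  have hQ : 0 ≤ Q := (abs_nonneg q).trans hq
  have hβ := h.nonneg
  set K := Q * β / (1 - θ) with hK
  have hK0 : 0 ≤ K := by positivity
  have hKeq : Q * β = K * (1 - θ) := (div_mul_cancel₀ _ hθ1.ne').symm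
  induction k generalizing l x y with
  | zero =>
    simp only [logPartition]
    positivity
  | succ k ih =>
    have hp := hxy.pred_eq
    simp only [logPartition]
    rw [← hp]
    refine log_sum_exp_le_add (h.mixing.pred_nonempty x) fun a ha => ?_
    have hag := hxy.prepend ha (hp ▸ ha)
    have h1 := le_of_abs_le (h.abs_mul_sub_le hq hag k)
    have h2 := ih (l + 1) hag
    -- This is exactly the slack in `K (1 - θ) θ + K θ ≤ K`, scaled by `θ ^ (l + 1)`.
    have h3 : 0 ≤ K * (1 - θ) ^ 2 * θ ^ (l + 1) := by positivity
    rw [pow_succ θ (l + 1)] at h1 h2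
    rw [hKeq] at h1
    nlinarith

lemma Regular.exists_logPartition_le (h : Regular b β θ p) (hq : |q| ≤ Q) (k : ℕ)
    (x : Subshift A) : ∃ y, shift y = x ∧
      logPartition b (k + 1) q x ≤ logPartition b k q y + (Real.log m + Q * β) := by
  obtain ⟨a, ha, h1⟩ := exists_log_sum_exp_le (h.mixing.pred_nonempty x)
    (fun a => q * b k (prepend a x) + logPartition b k q (prepend a x))
  refine ⟨prepend a x, shift_prepend ha, ?_⟩
  have h2 := le_of_abs_le (h.abs_mul_le hq k (prepend a x))
  have h3 : Real.log (pred x).card ≤ Real.log m := by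
    refine Real.log_le_log (by exact_mod_cast (h.mixing.pred_nonempty x).card_pos) ?_
    exact_mod_cast (Finset.card_le_univ _).trans_eq (Fintype.card_fin m)
  simp only [logPartition] at h1 ⊢
  linarith

lemma Regular.exists_logPartition_le_iterate (h : Regular b β θ p) (hq : |q| ≤ Q) (k j : ℕ)
    (x : Subshift A) : ∃ y, shift^[j] y = x ∧
      logPartition b (k + j) q x ≤ logPartition b k q y + j * (Real.log m + Q * β) := by
  induction j generalizing x with
  | zero => exact ⟨x, rfl, by simp⟩
  | succ j ih =>
    obtain ⟨z, hz, h1⟩ := h.exists_logPartition_le hq (k + j) x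
    obtain ⟨y, hy, h2⟩ := ih z
    refine ⟨y, by rw [Function.iterate_succ_apply', hy, hz], ?_⟩
    rw [← add_assoc]
    push_cast
    linarith

/-- A bound for the oscillation of `logPartition`. -/
def oscBound (m p : ℕ) (β θ Q : ℝ) : ℝ := p * (Real.log m + 2 * (Q * β)) + Q * β / (1 - θ)

/-- Going back `p` steps costs a bounded amount, and by mixing the preimage of `y` can be given the
first symbol of a dominant preimage of `x`; distortion then compares the two. If `k ≤ p`, both sides
are bounded directly. -/
lemma Regular.logPartition_le_add_oscBound (h : Regular b β θ p) (hq : |q| ≤ Q) (k : ℕ)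
    (x y : Subshift A) :
    logPartition b k q x ≤ logPartition b k q y + oscBound m p β θ Q := by
  have hθ := h.rate_pos
  have hθ1 : 0 < 1 - θ := sub_pos.2 h.rate_lt_one
  have hQ : 0 ≤ Q := (abs_nonneg q).trans hq
  have hβ := h.nonneg
  have hK : 0 ≤ Q * β / (1 - θ) := by positivity
  have hQβ : 0 ≤ Q * β := by positivity
  have hm : 0 ≤ Real.log m := Real.log_natCast_nonneg m
  unfold oscBound
  rcases le_total p k with hpk | hkp
  · obtain ⟨j, rfl⟩ := Nat.exists_eq_add_of_le' hpk
    obtain ⟨x', -, h1⟩ := h.exists_logPartition_le_iterate hq j p x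
    obtain ⟨y', hy0, hy⟩ := h.mixing.2 (x'.1 0) y
    have h2 := h.le_logPartition_iterate hq j p y'
    rw [hy] at h2
    have hag : Agree (0 + 1) x' y' := fun i hi => by
      obtain rfl : i = 0 := by omega
      exact hy0.symm
    have h3 := h.logPartition_le_add hq j 0 hag
    have h4 : Q * β / (1 - θ) * θ ^ (0 + 1) ≤ Q * β / (1 - θ) :=
      mul_le_of_le_one_right hK (by simpa using h.rate_lt_one.le)
    linarith
  · obtain ⟨x', -, h1⟩ := h.exists_logPartition_le_iterate hq 0 k x
    obtain ⟨y', hy, -⟩ := h.exists_logPartition_le_iterate hq 0 k y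
    have h2 := h.le_logPartition_iterate hq 0 k y'
    rw [hy] at h2
    simp only [zero_add, logPartition] at h1 h2
    have h5 : (k : ℝ) ≤ p := by exact_mod_cast hkp
    have h6 := mul_le_mul_of_nonneg_right h5 (by positivity : 0 ≤ Real.log m + 2 * (Q * β))
    linarith

/-- A lower bound for the transition probabilities. -/
def minWeight (m p : ℕ) (β θ Q : ℝ) : ℝ :=
  Real.exp (-(2 * (Q * β) + Real.log m + oscBound m p β θ Q))

lemma Regular.minWeight_le (h : Regular b β θ p) (hq : |q| ≤ Q) (k : ℕ) (x : Subshift A)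
    (a : Fin m) : minWeight m p β θ Q ≤ weight b k q x a := by
  obtain ⟨y, -, h1⟩ := h.exists_logPartition_le hq k x
  have h2 := h.logPartition_le_add_oscBound hq k y (prepend a x)
  have h3 := neg_le_of_abs_le (h.abs_mul_le hq k (prepend a x))
  exact Real.exp_le_exp.2 (by linarith)

lemma abs_exp_sub_one_le_mul_exp (s : ℝ) : |Real.exp s - 1| ≤ |s| * Real.exp |s| := by
  have h1 := Real.add_one_le_exp s
  have h2 := Real.add_one_le_exp (-s)
  have h3 : Real.exp s * Real.exp (-s) = 1 := by rw [← Real.exp_add]; simp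
  have hp := Real.exp_pos s
  rcases le_total 0 s with hs | hs
  · rw [abs_of_nonneg hs, abs_of_nonneg (by linarith)]
    nlinarith
  · have h4 : 1 ≤ Real.exp (-s) := Real.one_le_exp (by linarith)
    rw [abs_of_nonpos hs, abs_of_nonpos (by linarith [Real.exp_le_one_iff.2 hs])]
    nlinarith

/-- The Lipschitz constant of the logarithms of the weights. -/
def logWeightConst (β θ Q : ℝ) : ℝ := Q * β + 2 * (Q * β / (1 - θ))

/-- The logarithm of a weight is a sum of three terms with known Hölder bounds; exponentiating gives
a relative error. -/
lemma Regular.abs_weight_sub_le (h : Regular b β θ p) (hq : |q| ≤ Q) (k l : ℕ)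
    {x y : Subshift A} (hxy : Agree (l + 1) x y) {a : Fin m} (ha : a ∈ pred x) :
    |weight b k q x a - weight b k q y a| ≤
      logWeightConst β θ Q * Real.exp (logWeightConst β θ Q) * θ ^ (l + 1) * weight b k q y a := by
  have hθ := h.rate_pos
  have hθ1 : 0 < 1 - θ := sub_pos.2 h.rate_lt_one
  have hQ : 0 ≤ Q := (abs_nonneg q).trans hq
  have hβ := h.nonneg
  have hag := hxy.prepend ha (hxy.pred_eq ▸ ha)
  have hpow : θ ^ (l + 1 + 1) ≤ θ ^ (l + 1) :=
    pow_le_pow_of_le_one hθ.le h.rate_lt_one.le (Nat.le_succ _)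
  have hpow1 : θ ^ (l + 1) ≤ 1 := pow_le_one₀ hθ.le h.rate_lt_one.le
  have h1 := abs_le.1 (h.abs_mul_sub_le hq hag k)
  have h2 := h.logPartition_le_add hq k (l + 1) hag
  have h2' := h.logPartition_le_add hq k (l + 1) hag.symm
  have h3 := h.logPartition_le_add hq (k + 1) l hxy
  have h3' := h.logPartition_le_add hq (k + 1) l hxy.symm
  have e1 := mul_le_mul_of_nonneg_left hpow (by positivity : 0 ≤ Q * β)
  have e2 := mul_le_mul_of_nonneg_left hpow (by positivity : 0 ≤ Q * β / (1 - θ))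
  set s := q * b k (prepend a x) + logPartition b k q (prepend a x) - logPartition b (k + 1) q x -
    (q * b k (prepend a y) + logPartition b k q (prepend a y) - logPartition b (k + 1) q y) with hs
  have hκ0 : 0 ≤ logWeightConst β θ Q := by unfold logWeightConst; positivity
  have hsle : |s| ≤ logWeightConst β θ Q * θ ^ (l + 1) := by
    rw [logWeightConst, abs_le]
    constructor <;> linarith
  have hsle' : |s| ≤ logWeightConst β θ Q := hsle.trans (mul_le_of_le_one_right hκ0 hpow1)
  have hw : weight b k q x a = weight b k q y a * Real.exp s := by
    rw [weight, weight, ← Real.exp_add, hs]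
    ring_nf
  have hwp := weight_pos (b := b) k q y a
  calc |weight b k q x a - weight b k q y a| = weight b k q y a * |Real.exp s - 1| := by
        rw [hw, ← abs_of_pos hwp, ← abs_mul, abs_of_pos hwp]; congr 1; ring
    _ ≤ weight b k q y a * (logWeightConst β θ Q * θ ^ (l + 1) *
          Real.exp (logWeightConst β θ Q)) := by
        refine mul_le_mul_of_nonneg_left ((abs_exp_sub_one_le_mul_exp s).trans ?_) hwp.le
        exact mul_le_mul hsle (Real.exp_le_exp.2 hsle') (Real.exp_pos _).le (by positivity)
    _ = _ := by ring

/-! ### The oscillation of the mean energy -/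

lemma Regular.abs_meanEnergy_le (h : Regular b β θ p) (k : ℕ) (q : ℝ) (x : Subshift A) :
    |meanEnergy b k q x| ≤ k * β := by
  induction k generalizing x with
  | zero => simp [meanEnergy]
  | succ k ih =>
    simp only [meanEnergy]
    refine (Finset.abs_sum_le_sum_abs _ _).trans ?_
    calc ∑ a ∈ pred x, |weight b k q x a * (b k (prepend a x) + meanEnergy b k q (prepend a x))|
        ≤ ∑ a ∈ pred x, weight b k q x a * (β + k * β) := by
          refine Finset.sum_le_sum fun a _ => ?_
          rw [abs_mul, abs_of_pos (weight_pos _ _ _ _)]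
          exact mul_le_mul_of_nonneg_left ((abs_add_le _ _).trans
            (add_le_add ((h.holder k).abs_le _) (ih _))) (weight_pos _ _ _ _).le
      _ = _ := by
        rw [← Finset.sum_mul, sum_weight h.mixing]
        push_cast; ring

lemma Regular.meanEnergy_succ_sub_le (h : Regular b β θ p) {k : ℕ} {O : ℝ}
    (hO : ∀ x y, meanEnergy b k q x - meanEnergy b k q y ≤ O) (x y : Subshift A) :
    meanEnergy b (k + 1) q x - meanEnergy b (k + 1) q y ≤ 2 * β + O := by
  obtain ⟨a, ha⟩ := h.mixing.pred_nonempty x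
  obtain ⟨a', ha'⟩ := h.mixing.pred_nonempty y
  have hpair : ∀ i ∈ pred x, ∀ j ∈ pred y,
      b k (prepend i x) + meanEnergy b k q (prepend i x) -
        (b k (prepend j y) + meanEnergy b k q (prepend j y)) ≤ 2 * β + O := fun i _ j _ => by
    linarith [(h.holder k).sub_le (prepend i x) (prepend j y), hO (prepend i x) (prepend j y)]
  -- With zero gain this only says that averages differ by no more than the values do.
  have := sum_sub_sum_le_of_pair (δ := 0) (ε := 0) (fun i _ => (weight_pos (b := b) k q x i).le)
    (sum_weight h.mixing k q x) (fun i _ => (weight_pos (b := b) k q y i).le)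
    (sum_weight h.mixing k q y) hpair ha ha' le_rfl (weight_pos _ _ _ _).le
    (weight_pos _ _ _ _).le le_rfl (by linarith [hpair a ha a' ha'])
  exact this.trans_eq (by ring)

lemma Regular.meanEnergy_add_sub_le (h : Regular b β θ p) {k : ℕ} {O : ℝ}
    (hO : ∀ x y, meanEnergy b k q x - meanEnergy b k q y ≤ O) (j : ℕ) (x y : Subshift A) :
    meanEnergy b (k + j) q x - meanEnergy b (k + j) q y ≤ 2 * β * j + O := by
  induction j generalizing x y with
  | zero => simpa using hO x y
  | succ j ih =>
    have := h.meanEnergy_succ_sub_le ih x y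
    rw [← add_assoc]
    push_cast
    linarith

/-- If the energies at `x` and `y` differ by less than `O`, the deficit persists at their images:
each step back towards the pair has probability at least `minWeight` for either point, whence the
exponent `2 * j`. -/
lemma Regular.meanEnergy_iterate_sub_le (h : Regular b β θ p) (hq : |q| ≤ Q) {k : ℕ} {O : ℝ}
    (hO : ∀ x y, meanEnergy b k q x - meanEnergy b k q y ≤ O) (j : ℕ) (x y : Subshift A) :
    meanEnergy b (k + j) q (shift^[j] x) - meanEnergy b (k + j) q (shift^[j] y) ≤
      2 * β * j + O - minWeight m p β θ Q ^ (2 * j) *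
        (O - (meanEnergy b k q x - meanEnergy b k q y)) := by
  induction j with
  | zero => simp
  | succ j ih =>
    rw [Function.iterate_succ_apply', Function.iterate_succ_apply', ← add_assoc]
    set x' := shift^[j] x
    set y' := shift^[j] y
    have hpair : ∀ i ∈ pred (shift x'), ∀ l ∈ pred (shift y'),
        b (k + j) (prepend i (shift x')) + meanEnergy b (k + j) q (prepend i (shift x')) -
        (b (k + j) (prepend l (shift y')) + meanEnergy b (k + j) q (prepend l (shift y'))) ≤
          2 * β + (2 * β * j + O) := fun i _ l _ => by
      linarith [(h.holder (k + j)).sub_le (prepend i (shift x')) (prepend l (shift y')),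
        h.meanEnergy_add_sub_le hO j (prepend i (shift x')) (prepend l (shift y'))]
    have hδ : 0 < minWeight m p β θ Q := Real.exp_pos _
    have := sum_sub_sum_le_of_pair (δ := minWeight m p β θ Q)
      (ε := minWeight m p β θ Q ^ (2 * j) * (O - (meanEnergy b k q x - meanEnergy b k q y)))
      (fun i _ => (weight_pos (b := b) (k + j) q (shift x') i).le)
      (sum_weight h.mixing (k + j) q (shift x'))
      (fun i _ => (weight_pos (b := b) (k + j) q (shift y') i).le)
      (sum_weight h.mixing (k + j) q (shift y')) hpair (head_mem_pred x') (head_mem_pred y') hδ.le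
      (h.minWeight_le hq _ _ _) (h.minWeight_le hq _ _ _)
      (mul_nonneg (by positivity) (by linarith [hO x y])) (by
        rw [prepend_shift, prepend_shift]
        linarith [(h.holder (k + j)).sub_le x' y'])
    refine this.trans_eq ?_
    push_cast
    ring

/-- An inequality of Lasota–Yorke type: the Hölder constant shrinks by `θ`, at the price of a
multiple of the oscillation. -/
lemma Regular.meanEnergy_succ_sub_le_of_agree (h : Regular b β θ p) (hq : |q| ≤ Q) {k : ℕ}
    {O κ : ℝ} (hO : ∀ x y, meanEnergy b k q x - meanEnergy b k q y ≤ O)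
    (hκ : ∀ l x y, Agree (l + 1) x y →
      meanEnergy b k q x - meanEnergy b k q y ≤ κ * θ ^ (l + 1))
    {l : ℕ} {x y : Subshift A} (hxy : Agree (l + 1) x y) :
    meanEnergy b (k + 1) q x - meanEnergy b (k + 1) q y ≤
      (θ * κ + β + logWeightConst β θ Q * Real.exp (logWeightConst β θ Q) * (2 * β + O)) *
        θ ^ (l + 1) := by
  have hθ := h.rate_pos
  have hp := hxy.pred_eq
  obtain ⟨a₀, -⟩ := h.mixing.pred_nonempty x
  have key := sum_sub_sum_le_of_close (s := pred x) (w := weight b k q x) (w' := weight b k q y)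
    (f := fun a => b k (prepend a x) + meanEnergy b k q (prepend a x))
    (f' := fun a => b k (prepend a y) + meanEnergy b k q (prepend a y))
    (η := (θ * κ + β) * θ ^ (l + 1))
    (ζ := logWeightConst β θ Q * Real.exp (logWeightConst β θ Q) * θ ^ (l + 1))
    (O := 2 * β + O) (c := b k (prepend a₀ y) + meanEnergy b k q (prepend a₀ y))
    (fun a _ => (weight_pos _ _ _ _).le) (sum_weight h.mixing k q x)
    (hp ▸ sum_weight h.mixing k q y) (fun a ha => ?_)
    (fun a ha => h.abs_weight_sub_le hq k l hxy ha) (fun a _ => ?_)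
  · have e : meanEnergy b (k + 1) q y = ∑ a ∈ pred x,
        weight b k q y a * (b k (prepend a y) + meanEnergy b k q (prepend a y)) := by
      rw [hp]; rfl
    rw [e]
    refine key.trans_eq ?_
    ring
  · have hag := hxy.prepend ha (hp ▸ ha)
    have h1 := le_of_abs_le ((h.holder k).abs_sub_le _ _ _ hag)
    have h2 := hκ _ _ _ hag
    have h3 : β * θ ^ (l + 1 + 1) ≤ β * θ ^ (l + 1) :=
      mul_le_mul_of_nonneg_left
        (pow_le_pow_of_le_one hθ.le h.rate_lt_one.le (Nat.le_succ _)) h.nonneg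
    rw [pow_succ θ (l + 1)] at h2
    linarith
  · rw [abs_le]
    constructor
    · linarith [(h.holder k).sub_le (prepend a₀ y) (prepend a y), hO (prepend a₀ y) (prepend a y)]
    · linarith [(h.holder k).sub_le (prepend a y) (prepend a₀ y), hO (prepend a y) (prepend a₀ y)]

/-- The oscillation of the mean energy is bounded independently of the number of steps. -/
theorem exists_meanEnergy_osc_bound (A : Matrix (Fin m) (Fin m) ℝ) (β θ Q : ℝ) (p : ℕ) :
    ∃ O : ℝ, ∀ b : ℕ → Subshift A → ℝ, Regular b β θ p → ∀ q, |q| ≤ Q → ∀ k x y,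
      meanEnergy b k q x - meanEnergy b k q y ≤ O := by
  by_cases hne : ∃ b : ℕ → Subshift A → ℝ, Regular b β θ p ∧ 0 ≤ Q
  swap
  · exact ⟨0, fun b hb q hq => absurd ⟨b, hb, (abs_nonneg q).trans hq⟩ hne⟩
  obtain ⟨b₀, h₀, hQ⟩ := hne
  have hθ := h₀.rate_pos
  have hθ1 : 0 < 1 - θ := sub_pos.2 h₀.rate_lt_one
  have hβ := h₀.nonneg
  set E := logWeightConst β θ Q * Real.exp (logWeightConst β θ Q) with hE
  have hE0 : 0 ≤ E := by
    rw [hE]; unfold logWeightConst; positivity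
  -- The Hölder constant `κ` below grows linearly in `O`, with slope `E / (1 - θ)`. Agreement on `r
  -- + 1` symbols brings its contribution down to `O / 2` plus a constant, which avoids circularity.
  obtain ⟨r, hr⟩ : ∃ r : ℕ, θ ^ r * (E / (1 - θ)) ≤ 1 / 2 := by
    have ht := (tendsto_pow_atTop_nhds_zero_of_lt_one hθ.le h₀.rate_lt_one).mul_const (E / (1 - θ))
    rw [zero_mul] at ht
    exact (ht.eventually (ge_mem_nhds (by norm_num : (0 : ℝ) < 1 / 2))).exists
  set N := p + r with hN
  set δ := minWeight m p β θ Q with hδ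
  have hδ0 : 0 < δ := Real.exp_pos _
  set c := (2 * β * E + β) / (1 - θ) with hc
  have hc0 : 0 ≤ c := by positivity
  -- The first two summands make the coupling gain over `N` steps at least the growth `2 * β * N`;
  -- the last one covers `k < N`.
  set O := 2 * c + 4 * β * N / δ ^ (2 * N) + 2 * β * N with hOdef
  have hO0 : 0 ≤ O := by positivity
  -- The fixed point of the recursion for the Hölder constant.
  set κ := (β + E * (2 * β + O)) / (1 - θ) with hκ
  have hκ0 : 0 ≤ κ := by positivity
  have hκrec : θ * κ + β + E * (2 * β + O) = κ := by
    have : κ * (1 - θ) = β + E * (2 * β + O) := div_mul_cancel₀ _ hθ1.ne'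
    linarith
  have hκr : κ * θ ^ (r + 1) ≤ O / 2 + c := by
    have h1 : θ ^ (r + 1) ≤ θ ^ r := pow_le_pow_of_le_one hθ.le h₀.rate_lt_one.le (Nat.le_succ _)
    have h2 : θ ^ r ≤ 1 := pow_le_one₀ hθ.le h₀.rate_lt_one.le
    calc κ * θ ^ (r + 1) ≤ κ * θ ^ r := mul_le_mul_of_nonneg_left h1 hκ0
      _ = (θ ^ r * (E / (1 - θ))) * O + c * θ ^ r := by rw [hκ, hc]; ring
      _ ≤ 1 / 2 * O + c * 1 := add_le_add (mul_le_mul_of_nonneg_right hr hO0)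
          (mul_le_mul_of_nonneg_left h2 hc0)
      _ = _ := by ring
  have hgain : 2 * β * N ≤ δ ^ (2 * N) * (O - κ * θ ^ (r + 1)) := by
    have hδN : 0 < δ ^ (2 * N) := pow_pos hδ0 _
    have h1 : 2 * β * N / δ ^ (2 * N) ≤ O - κ * θ ^ (r + 1) := by
      have h2 : 0 ≤ β * N := by positivity
      have h3 : 4 * β * N / δ ^ (2 * N) = 2 * (2 * β * N / δ ^ (2 * N)) := by ring
      linarith
    rwa [div_le_iff₀' hδN] at h1
  refine ⟨O, fun b h q hq k => ?_⟩
  -- Each bound needs the other: the oscillation at `k` uses both at `k - N`, the Hölder bound uses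
  -- both at `k - 1`.
  suffices H : (∀ x y, meanEnergy b k q x - meanEnergy b k q y ≤ O) ∧
      ∀ l x y, Agree (l + 1) x y →
        meanEnergy b k q x - meanEnergy b k q y ≤ κ * θ ^ (l + 1) from H.1
  induction k using Nat.strong_induction_on with
  | _ k ih =>
    constructor
    · intro x y
      rcases lt_or_ge k N with hk | hk
      · have h1 := h.meanEnergy_add_sub_le (q := q) (k := 0) (O := 0)
          (fun x y => by simp [meanEnergy]) k x y
        rw [zero_add] at h1
        have h2 : (k : ℝ) ≤ N := by exact_mod_cast hk.le
        have h3 := mul_le_mul_of_nonneg_left h2 (by positivity : 0 ≤ 2 * β)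
        have h4 : 0 ≤ 4 * β * N / δ ^ (2 * N) := by positivity
        linarith
      · obtain ⟨j, rfl⟩ := Nat.exists_eq_add_of_le' hk
        have hp := h.mixing.1
        obtain ⟨hj1, hj2⟩ := ih j (by omega)
        obtain ⟨x', y', hag, rfl, rfl⟩ := h.mixing.exists_agree r x y
        have h1 := h.meanEnergy_iterate_sub_le hq hj1 N x' y'
        have h2 := hj2 r x' y' hag
        have h3 : δ ^ (2 * N) * (O - κ * θ ^ (r + 1)) ≤
            δ ^ (2 * N) * (O - (meanEnergy b j q x' - meanEnergy b j q y')) :=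
          mul_le_mul_of_nonneg_left (by linarith) (by positivity)
        linarith
    · intro l x y hxy
      cases k with
      | zero => simp only [meanEnergy, sub_self]; positivity
      | succ k =>
        obtain ⟨hk1, hk2⟩ := ih k (Nat.lt_succ_self k)
        have h1 := h.meanEnergy_succ_sub_le_of_agree hq hk1 hk2 hxy
        rwa [← hE, hκrec] at h1

/-- The second derivative of `logPartition` grows at most linearly in the number of steps. -/
theorem exists_energyVar_bound (A : Matrix (Fin m) (Fin m) ℝ) (β θ Q : ℝ) (p : ℕ) :
    ∃ C : ℝ, 0 ≤ C ∧ ∀ b : ℕ → Subshift A → ℝ, Regular b β θ p → ∀ q, |q| ≤ Q → ∀ k x,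
      |energyVar b k q x| ≤ k * C := by
  obtain ⟨O, hO⟩ := exists_meanEnergy_osc_bound A β θ Q p
  refine ⟨(2 * β + O) ^ 2, sq_nonneg _, fun b h q hq k => ?_⟩
  induction k with
  | zero => simp [energyVar]
  | succ k ih =>
    intro x
    set u := fun a => b k (prepend a x) + meanEnergy b k q (prepend a x) with hu
    set w := weight b k q x with hw
    have hw0 : ∀ a, 0 < w a := weight_pos k q x
    have hw1 : ∑ a ∈ pred x, w a = 1 := sum_weight h.mixing k q x
    set U := meanEnergy b (k + 1) q x with hU
    have hUeq : U = ∑ a ∈ pred x, w a * u a := rfl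
    have hpair : ∀ a a', u a - u a' ≤ 2 * β + O := fun a a' => by
      linarith [(h.holder k).sub_le (prepend a x) (prepend a' x),
        hO b h q hq k (prepend a x) (prepend a' x)]
    have hdev : ∀ a, |u a - U| ≤ 2 * β + O := fun a => by
      have e : u a - U = ∑ a' ∈ pred x, w a' * (u a - u a') := by
        simp only [mul_sub, Finset.sum_sub_distrib, ← Finset.sum_mul, hw1, hUeq, one_mul]
      rw [e]
      refine (Finset.abs_sum_le_sum_abs _ _).trans ?_
      calc ∑ a' ∈ pred x, |w a' * (u a - u a')| ≤ ∑ a' ∈ pred x, w a' * (2 * β + O) := by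
            refine Finset.sum_le_sum fun a' _ => ?_
            rw [abs_mul, abs_of_pos (hw0 a')]
            exact mul_le_mul_of_nonneg_left (abs_le.2 ⟨by linarith [hpair a' a], hpair a a'⟩)
              (hw0 a').le
        _ = _ := by rw [← Finset.sum_mul, hw1, one_mul]
    -- Law of total variance: `u - U` has mean zero, so the factor `u` may be replaced by `u - U`.
    have hvar : energyVar b (k + 1) q x =
        ∑ a ∈ pred x, w a * ((u a - U) ^ 2 + energyVar b k q (prepend a x)) := by
      have e : ∀ a, w a * ((u a - U) * u a + energyVar b k q (prepend a x)) =
          w a * ((u a - U) ^ 2 + energyVar b k q (prepend a x)) +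
            (w a * u a * U - w a * (U * U)) := fun a => by ring
      change ∑ a ∈ pred x, w a * ((u a - U) * u a + energyVar b k q (prepend a x)) = _
      simp only [e]
      rw [Finset.sum_add_distrib, Finset.sum_sub_distrib, ← Finset.sum_mul, ← Finset.sum_mul, hw1,
        ← hUeq]
      ring
    rw [hvar]
    refine (Finset.abs_sum_le_sum_abs _ _).trans ?_
    calc ∑ a ∈ pred x, |w a * ((u a - U) ^ 2 + energyVar b k q (prepend a x))|
        ≤ ∑ a ∈ pred x, w a * ((2 * β + O) ^ 2 + k * (2 * β + O) ^ 2) := by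
          refine Finset.sum_le_sum fun a _ => ?_
          rw [abs_mul, abs_of_pos (hw0 a)]
          refine mul_le_mul_of_nonneg_left ((abs_add_le _ _).trans (add_le_add ?_ (ih _)))
            (hw0 a).le
          rw [abs_pow]
          exact pow_le_pow_left₀ (abs_nonneg _) (hdev a) 2
      _ = _ := by
        rw [← Finset.sum_mul, hw1]
        push_cast
        ring

end

/-! ### Partition sums over preimages -/

open Classical in
/-- The points `y` with `σᵏ y = x`. -/
def preimages : ℕ → Subshift A → Finset (Subshift A)
  | 0, x => {x}
  | k + 1, x => (pred x).biUnion fun a => preimages k (prepend a x)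

lemma mem_preimages {k : ℕ} {x y : Subshift A} : y ∈ preimages k x ↔ shift^[k] y = x := by
  classical
  induction k generalizing x with
  | zero => simp [preimages]
  | succ k ih =>
    simp only [preimages, Finset.mem_biUnion, ih, Function.iterate_succ_apply']
    constructor
    · rintro ⟨a, ha, h⟩
      rw [h, shift_prepend ha]
    · rintro rfl
      exact ⟨_, head_mem_pred _, (prepend_shift _).symm⟩

/-- The recursion sorts the preimages `y` of order `k + 1` by the first symbol of `shift^[k] y`. -/
lemma exp_logPartition [NeZero m] {p : ℕ} (hA : Mixing A p) (b : ℕ → Subshift A → ℝ) (k : ℕ)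
    (q : ℝ) (x : Subshift A) : Real.exp (logPartition b k q x) =
      ∑ y ∈ preimages k x, Real.exp (q * ∑ j ∈ Finset.range k, b j (shift^[j] y)) := by
  classical
  induction k generalizing x with
  | zero => simp [logPartition, preimages]
  | succ k ih =>
    have hdisj : Set.PairwiseDisjoint (↑(pred x)) fun a => preimages k (prepend a x) := by
      intro a ha a' ha' hne
      refine Finset.disjoint_left.2 fun y hy hy' => hne ?_
      rw [mem_preimages] at hy hy'
      rw [← prepend_val_zero ha, ← prepend_val_zero ha', ← hy, ← hy']
    simp only [logPartition, preimages]
    rw [Real.exp_log (Finset.sum_pos (fun a _ => Real.exp_pos _) (hA.pred_nonempty x)),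
      Finset.sum_biUnion hdisj]
    refine Finset.sum_congr rfl fun a _ => ?_
    rw [Real.exp_add, ih, Finset.mul_sum]
    refine Finset.sum_congr rfl fun y hy => ?_
    rw [← Real.exp_add, Finset.sum_range_succ, mem_preimages.1 hy]
    ring_nf

/-! ### Words and cylinders -/

lemma iterate_shift_val (n k : ℕ) (x : Subshift A) : (shift^[n] x).1 k = x.1 (k + n) := by
  induction n generalizing x with
  | zero => rfl
  | succ n ih =>
    rw [Function.iterate_succ_apply, ih]
    exact congrArg x.1 (by omega)

/-- The word formed by the first `n` symbols. -/
def word (n : ℕ) (x : Subshift A) : Fin n → Fin m := fun i => x.1 i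

lemma word_mem_admissibleWords (n : ℕ) (x : Subshift A) : word n x ∈ admissibleWords A n := by
  simp only [admissibleWords, Finset.mem_filter, Finset.mem_univ, true_and]
  intro i j hij
  rw [word, word, hij]
  exact x.2 i

lemma mem_cylinder_word (n : ℕ) (x : Subshift A) : x ∈ cylinder A (word n x) := fun _ => rfl

lemma agree_of_mem_cylinder {n : ℕ} {J : Fin n → Fin m} {x y : Subshift A} (hx : x ∈ cylinder A J)
    (hy : y ∈ cylinder A J) : Agree n x y := fun i hi =>
  (hx ⟨i, hi⟩).trans (hy ⟨i, hi⟩).symm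

lemma eq_of_agree_of_iterate_shift {n : ℕ} {x y : Subshift A} (h : Agree n x y)
    (hs : shift^[n] x = shift^[n] y) : x = y := by
  refine Subtype.ext (funext fun k => ?_)
  rcases lt_or_ge k n with hk | hk
  · exact h k hk
  · obtain ⟨j, rfl⟩ := Nat.exists_eq_add_of_le' hk
    rw [← iterate_shift_val, ← iterate_shift_val, hs]

/-- An admissible word `J` can be prepended to `x` if its last symbol may precede `x`. -/
lemma exists_concat {n : ℕ} {J : Fin n → Fin m} (hJ : J ∈ admissibleWords A n) (x : Subshift A)
    (hx : ∀ i : Fin n, (i : ℕ) + 1 = n → A (J i) (x.1 0) = 1) :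
    ∃ y ∈ cylinder A J, shift^[n] y = x := by
  simp only [admissibleWords, Finset.mem_filter, Finset.mem_univ, true_and] at hJ
  set f : ℕ → Fin m := fun k => if h : k < n then J ⟨k, h⟩ else x.1 (k - n) with hf
  have hlt : ∀ k (h : k < n), f k = J ⟨k, h⟩ := fun k h => dif_pos h
  have hge : ∀ k, f (k + n) = x.1 k := fun k => by
    rw [hf]
    simp
  have hadm : ∀ k, A (f k) (f (k + 1)) = 1 := fun k => by
    rcases lt_trichotomy (k + 1) n with h | h | h
    · rw [hlt k (by omega), hlt (k + 1) h]
      exact hJ _ _ rfl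
    · rw [hlt k (by omega), show k + 1 = 0 + n by omega, hge]
      exact hx _ h
    · obtain ⟨j, rfl⟩ := Nat.exists_eq_add_of_le' (by omega : n ≤ k)
      rw [Nat.add_right_comm, hge, hge]
      exact x.2 j
  refine ⟨⟨f, hadm⟩, fun i => hlt i i.2, Subtype.ext (funext fun k => ?_)⟩
  exact (iterate_shift_val n k ⟨f, hadm⟩).trans (hge k)

lemma exists_concat_of_choice [NeZero m] (hA01 : ∀ i j, A i j = 0 ∨ A i j = 1)
    (hA : A.IsPrimitive) {pt : Fin m → Subshift A} (hpt : ∀ a, (pt a).1 0 = a) {n : ℕ}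
    {J : Fin n → Fin m} (hJ : J ∈ admissibleWords A n) :
    ∃ y ∈ cylinder A J, ∃ a, shift^[n] y = pt a := by
  cases n with
  | zero =>
    obtain ⟨y, hy, h⟩ := exists_concat hJ (pt 0) fun i => i.elim0
    exact ⟨y, hy, _, h⟩
  | succ n =>
    obtain ⟨a, ha⟩ := exists_succ hA01 hA (J (Fin.last n))
    obtain ⟨y, hy, h⟩ := exists_concat hJ (pt a) fun i hi => by
      rw [hpt, ← ha]
      congr
      exact Fin.ext (by simpa using hi)
    exact ⟨y, hy, _, h⟩

/-! ### Comparison of partition sums -/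

/-- The cocycle has increments that are bounded and Hölder continuous, uniformly in the length, and
it is almost multiplicative. -/
structure CocycleBound (M : Subshift A → Matrix (Fin d) (Fin d) ℝ) (β θ : ℝ) : Prop where
  nonneg : 0 ≤ β
  rate_pos : 0 < θ
  rate_lt_one : θ < 1
  entrySum_pos : ∀ n x, 0 < entrySum (cocycle M n x)
  holder : ∀ n, HolderBound β θ (logIncr M n)
  abs_add_sub_le : ∀ n k x,
    |logNorm M (n + k) x - (logNorm M n x + logNorm M k (shift^[n] x))| ≤ β

lemma logNorm_zero (M : Subshift A → Matrix (Fin d) (Fin d) ℝ) (x : Subshift A) :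
    logNorm M 0 x = Real.log d := by
  simp [logNorm, cocycle_zero, entrySum, Matrix.one_apply]

/-- The increments whose sum along an orbit of length `n` is `logNorm M n`. -/
def incrSeq (M : Subshift A → Matrix (Fin d) (Fin d) ℝ) (n j : ℕ) : Subshift A → ℝ :=
  logIncr M (n - 1 - j)

lemma sum_incrSeq (M : Subshift A → Matrix (Fin d) (Fin d) ℝ) (n : ℕ) (x : Subshift A) :
    ∑ j ∈ Finset.range n, incrSeq M n j (shift^[j] x) = logNorm M n x - Real.log d := by
  have h : ∀ k ≤ n, ∑ j ∈ Finset.range k, incrSeq M n j (shift^[j] x) =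
      logNorm M n x - logNorm M (n - k) (shift^[k] x) := by
    intro k hk
    induction k with
    | zero => simp
    | succ k ih =>
      rw [Finset.sum_range_succ, ih (by omega), incrSeq, logIncr, Function.iterate_succ_apply',
        show n - 1 - k + 1 = n - k by omega, show n - 1 - k = n - (k + 1) by omega]
      ring
  rw [h n le_rfl, Nat.sub_self, logNorm_zero]

section

variable {M : Subshift A → Matrix (Fin d) (Fin d) ℝ} {β θ : ℝ}

lemma CocycleBound.regular (h : CocycleBound M β θ) {p : ℕ} (hA : Mixing A p) (n : ℕ) :
    Regular (incrSeq M n) β θ p :=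
  ⟨h.nonneg, h.rate_pos, h.rate_lt_one, hA, fun _ => h.holder _⟩

lemma CocycleBound.abs_logNorm_le (h : CocycleBound M β θ) (n : ℕ) (x : Subshift A) :
    |logNorm M n x| ≤ Real.log d + n * β := by
  have h1 : |logNorm M n x - Real.log d| ≤ n * β := by
    rw [← sum_incrSeq]
    refine (Finset.abs_sum_le_sum_abs _ _).trans ?_
    refine (Finset.sum_le_sum fun j _ => (h.holder _).abs_le _).trans_eq ?_
    simp
  have h2 := abs_add_le (Real.log d) (logNorm M n x - Real.log d)
  rw [add_sub_cancel, abs_of_nonneg (Real.log_natCast_nonneg d)] at h2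
  linarith

lemma CocycleBound.abs_logNorm_sub_le (h : CocycleBound M β θ) {n : ℕ} {x y : Subshift A}
    (hxy : Agree n x y) : |logNorm M n x - logNorm M n y| ≤ β / (1 - θ) := by
  have hθ := h.rate_pos
  have hθ1 : 0 < 1 - θ := sub_pos.2 h.rate_lt_one
  have hβ := h.nonneg
  set K := β / (1 - θ) with hK
  have hK0 : 0 ≤ K := by positivity
  have hKeq : K * (1 - θ) = β := div_mul_cancel₀ _ hθ1.ne'
  -- The partial sum of the geometric series is carried along because the bound `K` alone is not
  -- inductive.
  suffices H : |logNorm M n x - logNorm M n y| ≤ K * (1 - θ ^ n) by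
    have : 0 ≤ K * θ ^ n := by positivity
    linarith
  induction n generalizing x y with
  | zero => simp [logNorm_zero]
  | succ n ih =>
    have h1 := (h.holder n).abs_sub_le _ _ _ hxy
    have h2 := ih hxy.shift
    have h3 := abs_add_le (logIncr M n x - logIncr M n y)
      (logNorm M n (shift x) - logNorm M n (shift y))
    have e : logIncr M n x - logIncr M n y + (logNorm M n (shift x) - logNorm M n (shift y)) =
        logNorm M (n + 1) x - logNorm M (n + 1) y := by rw [logIncr, logIncr]; ring
    rw [e] at h3
    have h4 : 0 ≤ K * θ ^ n * (1 - θ) ^ 2 := by positivity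
    rw [← hKeq, pow_succ] at h1
    rw [pow_succ]
    nlinarith

lemma CocycleBound.entrySum_rpow (h : CocycleBound M β θ) (n : ℕ) (q : ℝ) (x : Subshift A) :
    entrySum (cocycle M n x) ^ q = Real.exp (q * logNorm M n x) := by
  rw [Real.rpow_def_of_pos (h.entrySum_pos n x), mul_comm, logNorm]

/-- The contribution of the word `J` to the partition sum. -/
def cylinderSup (M : Subshift A → Matrix (Fin d) (Fin d) ℝ) (q : ℝ) {n : ℕ} (J : Fin n → Fin m) :
    ℝ := ⨆ x : cylinder A J, entrySum (cocycle M n x.1) ^ q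

lemma CocycleBound.exp_le_exp_of_mem (h : CocycleBound M β θ) {q : ℝ} {n : ℕ}
    {J : Fin n → Fin m} {x y : Subshift A} (hx : x ∈ cylinder A J) (hy : y ∈ cylinder A J) :
    Real.exp (q * logNorm M n x) ≤
      Real.exp (|q| * (β / (1 - θ))) * Real.exp (q * logNorm M n y) := by
  rw [← Real.exp_add, Real.exp_le_exp]
  have h1 : |q * (logNorm M n x - logNorm M n y)| ≤ |q| * (β / (1 - θ)) := by
    rw [abs_mul]
    exact mul_le_mul_of_nonneg_left (h.abs_logNorm_sub_le (agree_of_mem_cylinder hx hy))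
      (abs_nonneg q)
  linarith [le_of_abs_le h1]

lemma CocycleBound.exp_le_cylinderSup (h : CocycleBound M β θ) {q : ℝ} {n : ℕ}
    {J : Fin n → Fin m} {x : Subshift A} (hx : x ∈ cylinder A J) :
    Real.exp (q * logNorm M n x) ≤ cylinderSup M q J := by
  rw [← h.entrySum_rpow]
  -- Bounded distortion shows that the supremum is over a bounded family, so that it is not the
  -- default value.
  refine le_ciSup (f := fun x : cylinder A J => entrySum (cocycle M n x.1) ^ q)
    ⟨Real.exp (|q| * (β / (1 - θ))) * Real.exp (q * logNorm M n x), ?_⟩ ⟨x, hx⟩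
  rintro _ ⟨y, rfl⟩
  simp only [h.entrySum_rpow]
  exact h.exp_le_exp_of_mem y.2 hx

lemma CocycleBound.cylinderSup_le (h : CocycleBound M β θ) {q : ℝ} {n : ℕ}
    {J : Fin n → Fin m} {x : Subshift A} (hx : x ∈ cylinder A J) :
    cylinderSup M q J ≤ Real.exp (|q| * (β / (1 - θ))) * Real.exp (q * logNorm M n x) := by
  have : Nonempty (cylinder A J) := ⟨⟨x, hx⟩⟩
  refine ciSup_le fun y => ?_
  rw [h.entrySum_rpow]
  exact h.exp_le_exp_of_mem y.2 hx

lemma CocycleBound.cylinderSup_nonneg (h : CocycleBound M β θ) (q : ℝ) {n : ℕ}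
    (J : Fin n → Fin m) : 0 ≤ cylinderSup M q J :=
  Real.iSup_nonneg fun x => by rw [h.entrySum_rpow]; exact (Real.exp_pos _).le

lemma CocycleBound.exp_le_partitionSum (h : CocycleBound M β θ) (q : ℝ) (n : ℕ)
    (x : Subshift A) : Real.exp (q * logNorm M n x) ≤ partitionSum M n q :=
  (h.exp_le_cylinderSup (mem_cylinder_word n x)).trans
    (Finset.single_le_sum (f := fun J => cylinderSup M q J)
      (fun J _ => h.cylinderSup_nonneg q J) (word_mem_admissibleWords n x))

/-- A preimage of order `n` of a given point is determined by its first `n` symbols. -/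
lemma CocycleBound.sum_preimages_le (h : CocycleBound M β θ) (q : ℝ) (n : ℕ) (x : Subshift A) :
    ∑ y ∈ preimages n x, Real.exp (q * logNorm M n y) ≤ partitionSum M n q := by
  classical
  have hinj : Set.InjOn (word n) (preimages n x : Set (Subshift A)) := fun y hy z hz hyz =>
    eq_of_agree_of_iterate_shift (agree_of_mem_cylinder (mem_cylinder_word n y)
      (hyz ▸ mem_cylinder_word n z)) ((mem_preimages.1 hy).trans (mem_preimages.1 hz).symm)
  calc ∑ y ∈ preimages n x, Real.exp (q * logNorm M n y)
      ≤ ∑ y ∈ preimages n x, cylinderSup M q (word n y) :=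
        Finset.sum_le_sum fun y _ => h.exp_le_cylinderSup (mem_cylinder_word n y)
    _ = ∑ J ∈ (preimages n x).image (word n), cylinderSup M q J := (Finset.sum_image hinj).symm
    _ ≤ ∑ J ∈ admissibleWords A n, cylinderSup M q J := by
        refine Finset.sum_le_sum_of_subset_of_nonneg ?_ fun J _ _ => h.cylinderSup_nonneg q J
        exact Finset.image_subset_iff.2 fun y _ => word_mem_admissibleWords n y

/-- Every admissible word continues into one of the `m` points `pt a`, so each cylinder contains a
preimage of some `pt a`; distortion replaces the supremum by the value there. -/
lemma CocycleBound.partitionSum_le [NeZero m] (h : CocycleBound M β θ)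
    (hA01 : ∀ i j, A i j = 0 ∨ A i j = 1) (hA : A.IsPrimitive) {pt : Fin m → Subshift A}
    (hpt : ∀ a, (pt a).1 0 = a) (q : ℝ) (n : ℕ) :
    partitionSum M n q ≤ Real.exp (|q| * (β / (1 - θ))) *
      ∑ a, ∑ y ∈ preimages n (pt a), Real.exp (q * logNorm M n y) := by
  classical
  have : Nonempty (Subshift A) := ⟨pt 0⟩
  choose! Y hY a ha using fun J (hJ : J ∈ admissibleWords A n) =>
    exists_concat_of_choice hA01 hA hpt hJ
  have hinj : Set.InjOn Y (admissibleWords A n : Set (Fin n → Fin m)) := fun J hJ J' hJ' hJJ =>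
    funext fun i => ((hY J hJ i).symm.trans (by rw [hJJ])).trans (hY J' hJ' i)
  have hdisj : Set.PairwiseDisjoint (↑(Finset.univ : Finset (Fin m)))
      fun a => preimages n (pt a) := by
    intro a _ a' _ hne
    refine Finset.disjoint_left.2 fun y hy hy' => hne ?_
    rw [mem_preimages] at hy hy'
    rw [← hpt a, ← hpt a', ← hy, ← hy']
  calc partitionSum M n q = ∑ J ∈ admissibleWords A n, cylinderSup M q J := rfl
    _ ≤ ∑ J ∈ admissibleWords A n, Real.exp (|q| * (β / (1 - θ))) *
          Real.exp (q * logNorm M n (Y J)) :=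
        Finset.sum_le_sum fun J hJ => h.cylinderSup_le (hY J hJ)
    _ = Real.exp (|q| * (β / (1 - θ))) *
          ∑ y ∈ (admissibleWords A n).image Y, Real.exp (q * logNorm M n y) := by
        rw [← Finset.mul_sum, Finset.sum_image hinj]
    _ ≤ _ := by
        refine mul_le_mul_of_nonneg_left ?_ (Real.exp_pos _).le
        rw [← Finset.sum_biUnion hdisj]
        refine Finset.sum_le_sum_of_subset_of_nonneg ?_ fun _ _ _ => (Real.exp_pos _).le
        refine Finset.image_subset_iff.2 fun J hJ => Finset.mem_biUnion.2 ⟨a J, Finset.mem_univ _, ?_⟩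
        exact mem_preimages.2 (ha J hJ)

lemma sum_preimages_eq [NeZero m] {p : ℕ} (hA : Mixing A p) (q : ℝ) (n : ℕ) (x : Subshift A) :
    ∑ y ∈ preimages n x, Real.exp (q * logNorm M n y) =
      Real.exp (q * Real.log d + logPartition (incrSeq M n) n q x) := by
  rw [Real.exp_add, exp_logPartition hA, Finset.mul_sum]
  refine Finset.sum_congr rfl fun y _ => ?_
  rw [sum_incrSeq, ← Real.exp_add]
  ring_nf

/-- The logarithm of the partition sum differs from `logPartition` by a bounded amount. -/
lemma CocycleBound.abs_log_partitionSum_sub_le [NeZero m] (h : CocycleBound M β θ)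
    (hA01 : ∀ i j, A i j = 0 ∨ A i j = 1) (hA : A.IsPrimitive) {p : ℕ} (hp : Mixing A p)
    (q : ℝ) (x : Subshift A) : ∃ C : ℝ, ∀ n,
      |Real.log (partitionSum M n q) - logPartition (incrSeq M n) n q x| ≤ C := by
  choose pt hpt using exists_point hA01 hA
  have hm : (0 : ℝ) < m := by exact_mod_cast Nat.pos_of_ne_zero (NeZero.ne m)
  set D := |q| * (β / (1 - θ))
  set H := oscBound m p β θ |q|
  have hD : 0 ≤ D := mul_nonneg (abs_nonneg q)
    (div_nonneg h.nonneg (sub_pos.2 h.rate_lt_one).le)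
  -- Read off from the oscillation bound for `x` against itself.
  have hH : 0 ≤ H := by
    have := (h.regular hp 0).logPartition_le_add_oscBound (q := q) le_rfl 0 x x
    linarith
  have hmlog : 0 ≤ Real.log m := Real.log_natCast_nonneg m
  refine ⟨D + H + Real.log m + |q * Real.log d|, fun n => ?_⟩
  have hs : 0 < partitionSum M n q := (Real.exp_pos _).trans_le (h.exp_le_partitionSum q n x)
  have hlow := h.sum_preimages_le q n x
  rw [sum_preimages_eq hp, ← Real.le_log_iff_exp_le hs] at hlow
  have hup := h.partitionSum_le hA01 hA hpt q n
  have hup2 : Real.log (partitionSum M n q) ≤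
      D + (Real.log m + (q * Real.log d + (logPartition (incrSeq M n) n q x + H))) := by
    rw [Real.log_le_iff_le_exp hs, Real.exp_add, Real.exp_add (Real.log m), Real.exp_log hm]
    refine hup.trans (mul_le_mul_of_nonneg_left ?_ (Real.exp_pos _).le)
    calc ∑ a, ∑ y ∈ preimages n (pt a), Real.exp (q * logNorm M n y)
        ≤ ∑ _a : Fin m, Real.exp (q * Real.log d + (logPartition (incrSeq M n) n q x + H)) := by
          refine Finset.sum_le_sum fun a _ => ?_
          rw [sum_preimages_eq hp, Real.exp_le_exp]
          linarith [(h.regular hp n).logPartition_le_add_oscBound (q := q) le_rfl n (pt a) x]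
      _ = _ := by simp
  rw [abs_le]
  constructor
  · linarith [neg_abs_le (q * Real.log d)]
  · linarith [le_abs_self (q * Real.log d)]

/-! ### Existence of the pressure -/

/-- The norm is almost multiplicative in both directions, so the sign of `q` plays no role. -/
lemma CocycleBound.cylinderSup_append_le (h : CocycleBound M β θ) (q : ℝ) {n k : ℕ}
    {J : Fin (n + k) → Fin m} (hJ : (cylinder A J).Nonempty) :
    cylinderSup M q J ≤ Real.exp (|q| * β) * (cylinderSup M q (fun i => J (Fin.castAdd k i)) *
      cylinderSup M q (fun i => J (Fin.natAdd n i))) := by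
  obtain ⟨x₀, hx₀⟩ := hJ
  have : Nonempty (cylinder A J) := ⟨⟨x₀, hx₀⟩⟩
  refine ciSup_le fun ⟨x, hx⟩ => ?_
  have h1 := h.exp_le_cylinderSup (q := q) (x := x) (J := fun i => J (Fin.castAdd k i))
    fun i => hx (Fin.castAdd k i)
  have h2 := h.exp_le_cylinderSup (q := q) (x := shift^[n] x) (J := fun i => J (Fin.natAdd n i))
    fun i => (iterate_shift_val n i x).trans
      ((congrArg x.1 (by simp [add_comm])).trans (hx (Fin.natAdd n i)))
  rw [h.entrySum_rpow]
  have h3 : q * logNorm M (n + k) x ≤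
      |q| * β + (q * logNorm M n x + q * logNorm M k (shift^[n] x)) := by
    have : |q * (logNorm M (n + k) x - (logNorm M n x + logNorm M k (shift^[n] x)))| ≤ |q| * β := by
      rw [abs_mul]
      exact mul_le_mul_of_nonneg_left (h.abs_add_sub_le n k x) (abs_nonneg q)
    linarith [le_of_abs_le this]
  refine (Real.exp_le_exp.2 h3).trans ?_
  rw [Real.exp_add, Real.exp_add]
  exact mul_le_mul_of_nonneg_left (mul_le_mul h1 h2 (Real.exp_pos _).le
    (h.cylinderSup_nonneg q _)) (Real.exp_pos _).le

lemma CocycleBound.partitionSum_add_le [NeZero m] (h : CocycleBound M β θ)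
    (hA01 : ∀ i j, A i j = 0 ∨ A i j = 1) (hA : A.IsPrimitive) (q : ℝ) (n k : ℕ) :
    partitionSum M (n + k) q ≤
      Real.exp (|q| * β) * (partitionSum M n q * partitionSum M k q) := by
  classical
  choose pt hpt using exists_point hA01 hA
  set φ : (Fin (n + k) → Fin m) → (Fin n → Fin m) × (Fin k → Fin m) := fun J =>
    (fun i => J (Fin.castAdd k i), fun i => J (Fin.natAdd n i)) with hφ
  have hinj : Set.InjOn φ (admissibleWords A (n + k) : Set (Fin (n + k) → Fin m)) :=
    fun J _ J' _ hJJ => funext fun i => by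
      refine Fin.addCases (fun i => ?_) (fun i => ?_) i
      · exact congrFun (congrArg Prod.fst hJJ) i
      · exact congrFun (congrArg Prod.snd hJJ) i
  calc partitionSum M (n + k) q = ∑ J ∈ admissibleWords A (n + k), cylinderSup M q J := rfl
    _ ≤ ∑ J ∈ admissibleWords A (n + k), Real.exp (|q| * β) *
          (cylinderSup M q (φ J).1 * cylinderSup M q (φ J).2) :=
        Finset.sum_le_sum fun J hJ => by
          obtain ⟨y, hy, -⟩ := exists_concat_of_choice hA01 hA hpt hJ
          exact h.cylinderSup_append_le q ⟨y, hy⟩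
    _ = Real.exp (|q| * β) * ∑ w ∈ (admissibleWords A (n + k)).image φ,
          cylinderSup M q w.1 * cylinderSup M q w.2 := by
        rw [← Finset.mul_sum, Finset.sum_image hinj]
    _ ≤ Real.exp (|q| * β) * ∑ w ∈ admissibleWords A n ×ˢ admissibleWords A k,
          cylinderSup M q w.1 * cylinderSup M q w.2 := by
        refine mul_le_mul_of_nonneg_left ?_ (Real.exp_pos _).le
        refine Finset.sum_le_sum_of_subset_of_nonneg ?_ fun w _ _ =>
          mul_nonneg (h.cylinderSup_nonneg q _) (h.cylinderSup_nonneg q _)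
        refine Finset.image_subset_iff.2 fun J hJ => ?_
        simp only [admissibleWords, Finset.mem_filter, Finset.mem_univ, true_and,
          Finset.mem_product] at hJ ⊢
        exact ⟨fun i j hij => hJ _ _ (by simpa using hij),
          fun i j hij => hJ _ _ (by simp [hij, add_assoc])⟩
    _ = _ := by
        rw [Finset.sum_product, ← Finset.sum_mul_sum]
        rfl

theorem CocycleBound.tendsto_pressure [NeZero m] (h : CocycleBound M β θ)
    (hA01 : ∀ i j, A i j = 0 ∨ A i j = 1) (hA : A.IsPrimitive) (q : ℝ) :
    Tendsto (fun n : ℕ => (1 / (n : ℝ)) * Real.log (partitionSum M n q)) atTop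
      (𝓝 (pressure M q)) := by
  obtain ⟨x, -⟩ := exists_point hA01 hA 0
  have hs : ∀ n, 0 < partitionSum M n q := fun n =>
    (Real.exp_pos _).trans_le (h.exp_le_partitionSum q n x)
  set c := |q| * β with hc
  have hc0 : 0 ≤ c := mul_nonneg (abs_nonneg q) h.nonneg
  -- Adding `c` absorbs the constant of submultiplicativity; it vanishes after division by `n`.
  set u : ℕ → ℝ := fun n => Real.log (partitionSum M n q) + c with hu
  have hsub : Subadditive u := fun n k => by
    have h1 := Real.log_le_log (hs _) (h.partitionSum_add_le hA01 hA q n k)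
    rw [Real.log_mul (Real.exp_pos _).ne' (mul_pos (hs n) (hs k)).ne', Real.log_exp,
      Real.log_mul (hs n).ne' (hs k).ne'] at h1
    simp only [hu]
    linarith
  have hbdd : BddBelow (Set.range fun n => u n / n) := by
    have hd : 0 ≤ Real.log d := Real.log_natCast_nonneg d
    refine ⟨-(|q| * (Real.log d + β)), ?_⟩
    rintro _ ⟨n, rfl⟩
    rcases Nat.eq_zero_or_pos n with rfl | hn
    · simp only [Nat.cast_zero, div_zero, Left.neg_nonpos_iff]
      exact mul_nonneg (abs_nonneg q) (add_nonneg hd h.nonneg)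
    · have hn1 : (1 : ℝ) ≤ n := by exact_mod_cast hn
      have h1 := (Real.le_log_iff_exp_le (hs n)).2 (h.exp_le_partitionSum q n x)
      have h2 : |q * logNorm M n x| ≤ |q| * (Real.log d + n * β) := by
        rw [abs_mul]
        exact mul_le_mul_of_nonneg_left (h.abs_logNorm_le n x) (abs_nonneg q)
      have h3 := neg_le_of_abs_le h2
      have h4 : |q| * Real.log d ≤ n * (|q| * Real.log d) :=
        le_mul_of_one_le_left (mul_nonneg (abs_nonneg q) hd) hn1
      rw [le_div_iff₀ (by linarith)]
      simp only [hu]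
      nlinarith
  have ht := hsub.tendsto_lim hbdd
  have h0 : Tendsto (fun n : ℕ => c / (n : ℝ)) atTop (𝓝 0) := tendsto_const_div_atTop_nhds_zero_nat c
  have hlim : Tendsto (fun n : ℕ => (1 / (n : ℝ)) * Real.log (partitionSum M n q)) atTop
      (𝓝 hsub.lim) := by
    have := ht.sub h0
    rw [sub_zero] at this
    refine this.congr fun n => ?_
    simp only [hu]
    ring
  rw [pressure, hlim.limUnder_eq]
  exact hlim

end

/-! ### Differentiability of the pressure -/

/-- A first order Taylor estimate for a function with bounded second derivative. -/
lemma abs_taylor_le {f f' f'' : ℝ → ℝ} {q r C : ℝ}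
    (hf : ∀ t ∈ Metric.ball q r, HasDerivAt f (f' t) t)
    (hf' : ∀ t ∈ Metric.ball q r, HasDerivAt f' (f'' t) t)
    (hC : ∀ t ∈ Metric.ball q r, |f'' t| ≤ C) {t : ℝ} (ht : t ∈ Metric.ball q r) :
    |f t - f q - f' q * (t - q)| ≤ C * |t - q| * |t - q| := by
  have hr : 0 < r := dist_nonneg.trans_lt ht
  have hq : q ∈ Metric.ball q r := Metric.mem_ball_self hr
  have hsub : ∀ s, |s - q| ≤ |t - q| → s ∈ Metric.ball q r := fun s hs => by
    rw [Metric.mem_ball, Real.dist_eq] at ht ⊢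
    exact hs.trans_lt ht
  have h1 : ∀ s ∈ Metric.closedBall q |t - q|, |f' s - f' q| ≤ C * |t - q| := fun s hs => by
    rw [Metric.mem_closedBall, Real.dist_eq] at hs
    have := (convex_ball q r).norm_image_sub_le_of_norm_hasDerivWithin_le
      (fun u hu => (hf' u hu).hasDerivWithinAt) hC hq (hsub s hs)
    refine this.trans (mul_le_mul_of_nonneg_left hs ((abs_nonneg _).trans (hC q hq)))
  have h2 := (convex_closedBall q |t - q|).norm_image_sub_le_of_norm_hasDerivWithin_le
    (f := fun s => f s - f' q * s) (f' := fun s => f' s - f' q) (x := q) (y := t)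
    (fun s hs => by
      have hs' : s ∈ Metric.ball q r := hsub s (by simpa [Real.dist_eq] using hs)
      have := (hf s hs').fun_sub ((hasDerivAt_id s).const_mul (f' q))
      simpa using this.hasDerivWithinAt) h1
    (Metric.mem_closedBall_self (abs_nonneg _)) (by simp [Real.dist_eq])
  simp only [Real.norm_eq_abs] at h2
  convert h2 using 2
  ring

/-- A pointwise limit of functions with uniformly bounded second derivatives, whose derivatives at
`q` are bounded, is differentiable at `q`. -/
lemma differentiableAt_of_tendsto {f f' f'' : ℕ → ℝ → ℝ} {P : ℝ → ℝ} {q r C B : ℝ} (hr : 0 < r)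
    (hf : ∀ n, ∀ t ∈ Metric.ball q r, HasDerivAt (f n) (f' n t) t)
    (hf' : ∀ n, ∀ t ∈ Metric.ball q r, HasDerivAt (f' n) (f'' n t) t)
    (hC : ∀ n, ∀ t ∈ Metric.ball q r, |f'' n t| ≤ C) (hB : ∀ n, |f' n q| ≤ B)
    (hP : ∀ t, Tendsto (fun n => f n t) atTop (𝓝 (P t))) : DifferentiableAt ℝ P q := by
  -- A subsequential limit of the slopes suffices: the Taylor estimate passes to the limit along it,
  -- and forces `s` to be the derivative of `P`.
  obtain ⟨s, -, φ, hφ, hs⟩ := tendsto_subseq_of_bounded (Metric.isBounded_closedBall (x := 0))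
    (fun n => by simpa [Real.dist_eq] using hB n : ∀ n, f' n q ∈ Metric.closedBall (0 : ℝ) B)
  have hlim : ∀ t ∈ Metric.ball q r, |P t - P q - s * (t - q)| ≤ C * |t - q| * |t - q| := by
    intro t ht
    have h1 : Tendsto (fun n => |f (φ n) t - f (φ n) q - f' (φ n) q * (t - q)|) atTop
        (𝓝 |P t - P q - s * (t - q)|) :=
      ((((hP t).comp hφ.tendsto_atTop).sub ((hP q).comp hφ.tendsto_atTop)).sub
        (hs.mul_const (t - q))).abs
    exact le_of_tendsto' h1 fun n => abs_taylor_le (hf _) (hf' _) (hC _) ht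
  refine HasDerivAt.differentiableAt (f' := s) ?_
  rw [hasDerivAt_iff_isLittleO]
  have hO : (fun t => P t - P q - (t - q) • s) =O[𝓝 q] fun t => (t - q) ^ 2 := by
    refine Asymptotics.IsBigO.of_bound C ?_
    filter_upwards [Metric.ball_mem_nhds q hr] with t ht
    have := hlim t ht
    rw [Real.norm_eq_abs, Real.norm_eq_abs, abs_pow, smul_eq_mul, mul_comm (t - q) s]
    linarith
  refine hO.trans_isLittleO ?_
  have := Asymptotics.isLittleO_pow_id (𝕜 := ℝ) (n := 2) (by norm_num)
  have ht : Tendsto (fun t : ℝ => t - q) (𝓝 q) (𝓝 0) :=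
    (continuous_sub_right q).tendsto' q 0 (sub_self q)
  exact this.comp_tendsto ht

theorem CocycleBound.differentiableAt_pressure [NeZero m]
    {M : Subshift A → Matrix (Fin d) (Fin d) ℝ} {β θ : ℝ} (h : CocycleBound M β θ)
    (hA01 : ∀ i j, A i j = 0 ∨ A i j = 1) (hA : A.IsPrimitive) (q : ℝ) :
    DifferentiableAt ℝ (pressure M) q := by
  obtain ⟨x, -⟩ := exists_point hA01 hA 0
  obtain ⟨p, hp⟩ := exists_mixing hA01 hA
  -- The bound `|q| + 1` covers the ball of radius one around `q`.
  obtain ⟨C, hC0, hC⟩ := exists_energyVar_bound A β θ (|q| + 1) p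
  have hscale : ∀ (n : ℕ) {u c : ℝ}, 0 ≤ c → |u| ≤ n * c → |1 / (n : ℝ) * u| ≤ c := by
    intro n u c hc hu
    rcases Nat.eq_zero_or_pos n with rfl | hn
    · simpa using hc
    · have hn0 : (0 : ℝ) < n := by exact_mod_cast hn
      rw [abs_mul, abs_of_pos (by positivity), one_div, inv_mul_le_iff₀ hn0]
      exact hu
  refine differentiableAt_of_tendsto (r := 1) (C := C) (B := β) one_pos
    (f := fun n t => 1 / (n : ℝ) * logPartition (incrSeq M n) n t x)
    (f' := fun n t => 1 / (n : ℝ) * meanEnergy (incrSeq M n) n t x)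
    (f'' := fun n t => 1 / (n : ℝ) * energyVar (incrSeq M n) n t x)
    (fun n t _ => (hasDerivAt_logPartition hp n t x).const_mul _)
    (fun n t _ => (hasDerivAt_meanEnergy hp n t x).const_mul _) (fun n t ht => ?_)
    (fun n => hscale n h.nonneg ((h.regular hp n).abs_meanEnergy_le n q x)) fun t => ?_
  · refine hscale n hC0 (hC _ (h.regular hp n) t ?_ n x)
    rw [Metric.mem_ball, Real.dist_eq] at ht
    have := abs_add_le q (t - q)
    rw [add_sub_cancel] at this
    linarith
  · obtain ⟨D, hD⟩ := h.abs_log_partitionSum_sub_le hA01 hA hp t x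
    have h0 : Tendsto (fun n : ℕ => 1 / (n : ℝ) *
        (Real.log (partitionSum M n t) - logPartition (incrSeq M n) n t x)) atTop (𝓝 0) := by
      refine squeeze_zero_norm (a := fun n : ℕ => D / (n : ℝ)) (fun n => ?_)
        (tendsto_const_div_atTop_nhds_zero_nat D)
      rw [Real.norm_eq_abs, abs_mul, abs_of_nonneg (by positivity), one_div_mul_eq_div]
      exact div_le_div_of_nonneg_right (hD n) (Nat.cast_nonneg n)
    have := (h.tendsto_pressure hA01 hA t).sub h0
    rw [sub_zero] at this
    exact this.congr fun n => by ring

end MatrixPressure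

end

theorem theorem1p2 (m d : ℕ) (hm : 2 ≤ m) (hd : 1 ≤ d)
    (A : Matrix (Fin m) (Fin m) ℝ) (hA01 : ∀ i j, A i j = 0 ∨ A i j = 1) (hA : A.IsPrimitive)
    (M : MatrixPressure.Subshift A → Matrix (Fin d) (Fin d) ℝ)
    (hM : MatrixPressure.IsHolder M) (hpos : ∀ x i j, 0 < M x i j) :
    (∀ q : ℝ, Filter.Tendsto
      (fun n : ℕ => (1 / (n : ℝ)) * Real.log (MatrixPressure.partitionSum M n q))
      Filter.atTop (nhds (MatrixPressure.pressure M q))) ∧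
    ∀ q : ℝ, q ≠ 0 → DifferentiableAt ℝ (MatrixPressure.pressure M) q := by
  have : NeZero m := ⟨by omega⟩
  have : NeZero d := ⟨by omega⟩
  obtain ⟨β, θ, hβ, hθ0, hθ1, hhol, hadd⟩ := MatrixPressure.exists_logNorm_bounds hm hM hpos
  have h : MatrixPressure.CocycleBound M β θ :=
    ⟨hβ, hθ0, hθ1, MatrixPressure.entrySum_cocycle_pos hpos, hhol, hadd⟩
  exact ⟨h.tendsto_pressure hA01 hA, fun q _ => h.differentiableAt_pressure hA01 hA q⟩
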